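/- Let $k$ be an algebraically closed field of characteristic $0$ and let $(A,R)$ be a semisimple triangular Hopf algebra over $k$: $A$ is a finite-dimensional Hopf algebra (comultiplication $\Delta$, antipode $S$), semisimple as an algebra, and $R=\sum_i a_i\otimes b_i\in A\otimes A$ is invertible with $R^{-1}=R_{21}$ and satisfies $(\Delta\otimes\mathrm{id})(R)=R_{13}R_{23}$, $(\mathrm{id}\otimes\Delta)(R)=R_{13}R_{12}$ and $\Delta^{\mathrm{cop}}(a)R=R\Delta(a)$ for all $a\in A$. Let $u=\sum_i S(b_i)a_i$ be its Drinfeld element and set $R_u=\frac12(1\otimes 1+1\otimes u+u\otimes 1-u\otimes u)$. Then: 1. $u$ is central and $u^2=1$; consequently every irreducible representation $V$ of $A$ has a unique parity $p(V)\in\mathbb Z/2$ with $u|_V=(-1)^{p(V)}\,\mathrm{id}_V$. 2. There is exactly one element $\tilde R\in A\otimes A$ such that $\tilde R|_{V\otimes W}=(-1)^{p(V)p(W)}R|_{V\otimes W}$ for all irreducible representations $V,W$ of $A$, and $\tilde R=RR_u$. 3. $(A,RR_u)$ is a semisimple triangular Hopf algebra, and its Drinfeld element is $1$. -/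

import Mathlib

open scoped TensorProduct

universe u v

namespace TriangularHopf

/-! Triangular Hopf algebras.  The triple tensor product is written `A ⊗ (A ⊗ A)`. -/

section Legs

variable (k : Type u) (A : Type v) [Field k] [Ring A] [Algebra k A]

/-- `a ⊗ b ↦ a ⊗ b ⊗ 1`, i.e. `X ↦ X₁₂`. -/
noncomputable def leg12 : A ⊗[k] A →ₐ[k] A ⊗[k] (A ⊗[k] A) :=
  Algebra.TensorProduct.map (AlgHom.id k A) Algebra.TensorProduct.includeLeft

/-- `a ⊗ b ↦ a ⊗ 1 ⊗ b`, i.e. `X ↦ X₁₃`. -/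
noncomputable def leg13 : A ⊗[k] A →ₐ[k] A ⊗[k] (A ⊗[k] A) :=
  Algebra.TensorProduct.map (AlgHom.id k A) Algebra.TensorProduct.includeRight

/-- `a ⊗ b ↦ 1 ⊗ a ⊗ b`, i.e. `X ↦ X₂₃`. -/
noncomputable def leg23 : A ⊗[k] A →ₐ[k] A ⊗[k] (A ⊗[k] A) :=
  Algebra.TensorProduct.includeRight

/-- The flip `τ : a ⊗ b ↦ b ⊗ a`, i.e. `X ↦ X₂₁`. -/
noncomputable def flip : A ⊗[k] A →ₐ[k] A ⊗[k] A :=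
  (Algebra.TensorProduct.comm k A A).toAlgHom

end Legs

section Triangular

variable (k : Type u) {A : Type v} [Field k] [Ring A] [HopfAlgebra k A]

/-- `(A, R)` is a triangular Hopf algebra: `R` is invertible with inverse `R₂₁`,
`(Δ ⊗ id)(R) = R₁₃ R₂₃`, `(id ⊗ Δ)(R) = R₁₃ R₁₂`, and `Δᶜᵒᵖ(a) R = R Δ(a)`. -/
structure IsTriangular (R : A ⊗[k] A) : Prop where
  mul_flip : R * flip k A R = 1
  flip_mul : flip k A R * R = 1
  comul_left :
    Algebra.TensorProduct.assoc k k k A A A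
        (Algebra.TensorProduct.map (Bialgebra.comulAlgHom k A) (AlgHom.id k A) R) =
      leg13 k A R * leg23 k A R
  comul_right :
    Algebra.TensorProduct.map (AlgHom.id k A) (Bialgebra.comulAlgHom k A) R =
      leg13 k A R * leg12 k A R
  comul_op : ∀ a : A,
    flip k A (Bialgebra.comulAlgHom k A a) * R = R * Bialgebra.comulAlgHom k A a

/-- `(A, R)` is a semisimple triangular Hopf algebra: it is triangular and the algebra `A` is
semisimple. -/
structure IsSemisimpleTriangular (R : A ⊗[k] A) : Prop extends IsTriangular k R where
  semisimple : IsSemisimpleRing A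

/-- The Drinfeld element `∑ S(bᵢ) aᵢ` of `R = ∑ aᵢ ⊗ bᵢ`. -/
noncomputable def drinfeldElement (R : A ⊗[k] A) : A :=
  LinearMap.mul' k A ((HopfAlgebra.antipode k (A := A)).rTensor A (flip k A R))

end Triangular

section Parity

variable (k : Type u) {A : Type v} [Field k] [Ring A] [Algebra k A]

/-- `R_u = ½ (1 ⊗ 1 + 1 ⊗ u + u ⊗ 1 - u ⊗ u)`. -/
noncomputable def parityMatrix (x : A) : A ⊗[k] A :=
  (2⁻¹ : k) • ((1 : A) ⊗ₜ[k] (1 : A) + (1 : A) ⊗ₜ[k] x + x ⊗ₜ[k] (1 : A) - x ⊗ₜ[k] x)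

/-- The action of `A ⊗ A` on `V ⊗ W`, `(a ⊗ b) (v ⊗ w) = a v ⊗ b w`. -/
noncomputable def tensorAction (V W : Type v)
    [AddCommGroup V] [Module k V] [Module A V] [IsScalarTower k A V]
    [AddCommGroup W] [Module k W] [Module A W] [IsScalarTower k A W] :
    A ⊗[k] A →ₐ[k] Module.End k (V ⊗[k] W) :=
  (Module.endTensorEndAlgHom (R := k) (S := k) (A := k) (M := V) (N := W)).comp
    (Algebra.TensorProduct.map (Algebra.lsmul k k V) (Algebra.lsmul k k W))

/-- `p` is a parity of the representation `V`: the element `x` acts on `V` as the scalar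
`(-1) ^ p`. -/
def HasParity (x : A) (V : Type v) [AddCommGroup V] [Module k V] [Module A V]
    (p : ZMod 2) : Prop :=
  ∀ w : V, x • w = ((-1 : k) ^ p.val) • w

/-- `R'` acts on `V ⊗ W` as `(-1) ^ (p(V) p(W)) R` for all irreducible representations `V`, `W`
of `A`, where parities are taken with respect to the element `x`.  (Every irreducible
`A`-module is a quotient of `A`, so it is enough to consider modules in the universe of `A`.) -/
def IsParityModification (x : A) (R R' : A ⊗[k] A) : Prop :=
  ∀ (V W : Type v)
    [AddCommGroup V] [Module k V] [Module A V] [IsScalarTower k A V] [IsSimpleModule A V]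
    [AddCommGroup W] [Module k W] [Module A W] [IsScalarTower k A W] [IsSimpleModule A W]
    (p q : ZMod 2), HasParity k x V p → HasParity k x W q →
      tensorAction k V W R' = ((-1 : k) ^ (p * q).val) • tensorAction k V W R

end Parity

end TriangularHopf

namespace TriangularHopf

open Coalgebra HopfAlgebra TensorProduct

section Multilinear

variable {k : Type*} {A B C M : Type*} [CommSemiring k]
  [AddCommMonoid A] [Module k A] [AddCommMonoid B] [Module k B] [AddCommMonoid C] [Module k C]
  [AddCommMonoid M] [Module k M]

/-- A function of two variables is `k`-bilinear. -/
structure IsBilin (k : Type*) {A B M : Type*} [CommSemiring k] [AddCommMonoid A] [Module k A]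
    [AddCommMonoid B] [Module k B] [AddCommMonoid M] [Module k M] (f : A → B → M) : Prop where
  add_left : ∀ x x' y, f (x + x') y = f x y + f x' y
  smul_left : ∀ (c : k) x y, f (c • x) y = c • f x y
  add_right : ∀ x y y', f x (y + y') = f x y + f x y'
  smul_right : ∀ (c : k) x y, f x (c • y) = c • f x y

/-- A function of three variables is `k`-trilinear. -/
structure IsTrilin (k : Type*) {A B C M : Type*} [CommSemiring k] [AddCommMonoid A] [Module k A]
    [AddCommMonoid B] [Module k B] [AddCommMonoid C] [Module k C] [AddCommMonoid M] [Module k M]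
    (f : A → B → C → M) : Prop where
  add₁ : ∀ x x' y z, f (x + x') y z = f x y z + f x' y z
  smul₁ : ∀ (c : k) x y z, f (c • x) y z = c • f x y z
  add₂ : ∀ x y y' z, f x (y + y') z = f x y z + f x y' z
  smul₂ : ∀ (c : k) x y z, f x (c • y) z = c • f x y z
  add₃ : ∀ x y z z', f x y (z + z') = f x y z + f x y z'
  smul₃ : ∀ (c : k) x y z, f x y (c • z) = c • f x y z

/-- The linear map on the tensor product given by a bilinear function. -/
noncomputable def IsBilin.lin {f : A → B → M} (hf : IsBilin k f) : A ⊗[k] B →ₗ[k] M :=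
  TensorProduct.lift (LinearMap.mk₂ k f hf.add_left hf.smul_left hf.add_right hf.smul_right)

@[simp] lemma IsBilin.lin_tmul {f : A → B → M} (hf : IsBilin k f) (x : A) (y : B) :
    hf.lin (x ⊗ₜ y) = f x y := by
  simp [IsBilin.lin]

lemma IsTrilin.isBilin_right {f : A → B → C → M} (hf : IsTrilin k f) (x : A) :
    IsBilin k (f x) :=
  ⟨hf.add₂ x, fun c => hf.smul₂ c x, hf.add₃ x, fun c => hf.smul₃ c x⟩

lemma IsTrilin.isBilin_lin {f : A → B → C → M} (hf : IsTrilin k f) :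
    IsBilin k (fun x (t : B ⊗[k] C) => (hf.isBilin_right x).lin t) where
  add_left x x' t := by
    induction t with
    | zero => simp
    | tmul y z => simp [hf.add₁]
    | add s t hs ht => simp only [map_add, hs, ht]; abel
  smul_left c x t := by
    induction t with
    | zero => simp
    | tmul y z => simp [hf.smul₁]
    | add s t hs ht => simp only [map_add, hs, ht, smul_add]
  add_right x s t := by simp
  smul_right c x t := by simp

/-- The linear map on the triple tensor product given by a trilinear function. -/
noncomputable def IsTrilin.lin {f : A → B → C → M} (hf : IsTrilin k f) :
    A ⊗[k] (B ⊗[k] C) →ₗ[k] M :=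
  hf.isBilin_lin.lin

@[simp] lemma IsTrilin.lin_tmul {f : A → B → C → M} (hf : IsTrilin k f) (x : A) (y : B) (z : C) :
    hf.lin (x ⊗ₜ (y ⊗ₜ z)) = f x y z := by
  simp [IsTrilin.lin]

end Multilinear

section Sweedler

variable {k : Type u} {A : Type v} {M : Type*} [Field k] [Ring A] [HopfAlgebra k A]
  [AddCommMonoid M] [Module k M]

/-- Coassociativity, evaluated on a trilinear function. -/
lemma sum_comul_comul {f : A → A → A → M} (hf : IsTrilin k f) (x : A) :
    ∑ p ∈ (ℛ k x).index, ∑ q ∈ (ℛ k ((ℛ k x).left p)).index,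
        f ((ℛ k ((ℛ k x).left p)).left q) ((ℛ k ((ℛ k x).left p)).right q) ((ℛ k x).right p) =
      ∑ p ∈ (ℛ k x).index, ∑ q ∈ (ℛ k ((ℛ k x).right p)).index,
        f ((ℛ k x).left p) ((ℛ k ((ℛ k x).right p)).left q)
          ((ℛ k ((ℛ k x).right p)).right q) := by
  have := congrArg hf.lin (sum_tmul_tmul_eq (R := k) (ℛ k x) (fun p => ℛ k ((ℛ k x).left p))
    (fun p => ℛ k ((ℛ k x).right p)))
  simpa only [map_sum, IsTrilin.lin_tmul] using this

lemma sum_counit_left (φ : A →ₗ[k] M) (x : A) :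
    ∑ p ∈ (ℛ k x).index, counit (R := k) ((ℛ k x).left p) • φ ((ℛ k x).right p) = φ x := by
  rw [← congrArg φ (sum_counit_smul (ℛ k x))]; simp

lemma sum_counit_right (φ : A →ₗ[k] M) (x : A) :
    ∑ p ∈ (ℛ k x).index, counit (R := k) ((ℛ k x).right p) • φ ((ℛ k x).left p) = φ x := by
  have := congrArg (TensorProduct.lift (LinearMap.lsmul k A).flip)
    (sum_tmul_counit_eq (R := k) (ℛ k x))
  simp only [map_sum, lift.tmul, LinearMap.flip_apply, LinearMap.lsmul_apply, one_smul] at this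
  rw [← congrArg φ this]; simp

lemma comul_mul_comul_antipode_flip (x : A) :
    ∑ p ∈ (ℛ k x).index, TensorProduct.map (antipode k) (antipode k)
        (TensorProduct.comm k A A (comul ((ℛ k x).left p))) * comul ((ℛ k x).right p) =
      algebraMap k (A ⊗[k] A) (counit x) := by
  have h1 : ∀ y s : A, ∑ q ∈ (ℛ k y).index,
      (antipode k ((ℛ k y).left q) ⊗ₜ[k] s) * comul ((ℛ k y).right q) = 1 ⊗ₜ (s * y) := by
    intro y s
    have hf : IsTrilin k (fun a b c : A => (antipode k a * b) ⊗ₜ[k] (s * c)) := by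
      constructor <;> intros <;> simp [mul_add, add_mul, tmul_add, add_tmul, ← smul_tmul']
    have h := sum_comul_comul hf y
    calc _ = _ := Finset.sum_congr rfl fun p _ => by
            conv_lhs => rw [← (ℛ k ((ℛ k y).right p)).eq, Finset.mul_sum]
            simp only [Algebra.TensorProduct.tmul_mul_tmul]
      _ = _ := h.symm
      _ = ∑ p ∈ (ℛ k y).index, counit (R := k) ((ℛ k y).left p) •
            ((TensorProduct.mk k A A 1) ∘ₗ LinearMap.mulLeft k s) ((ℛ k y).right p) :=
          Finset.sum_congr rfl fun p _ => by
            rw [← sum_tmul, sum_antipode_mul_eq_smul]; simp [smul_tmul']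
      _ = _ := by rw [sum_counit_left]; simp
  have hf : IsTrilin k (fun a b c : A => (antipode k b ⊗ₜ[k] antipode k a) * comul c) := by
    constructor <;> intros <;> simp [mul_add, add_mul, tmul_add, add_tmul, ← smul_tmul']
  have h := sum_comul_comul hf x
  calc _ = _ := Finset.sum_congr rfl fun p _ => by
            conv_lhs => rw [← (ℛ k ((ℛ k x).left p)).eq]
            simp only [map_sum, comm_tmul, _root_.TensorProduct.map_tmul, Finset.sum_mul]
    _ = _ := h
    _ = ∑ p ∈ (ℛ k x).index, 1 ⊗ₜ[k] (antipode k ((ℛ k x).left p) * (ℛ k x).right p) :=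
          Finset.sum_congr rfl fun p _ => h1 _ _
    _ = _ := by
      rw [← tmul_sum, sum_antipode_mul_eq_smul, tmul_smul, Algebra.algebraMap_eq_smul_one]; rfl

/-- The antipode is an anti-coalgebra map. -/
lemma comul_antipode (x : A) :
    comul (antipode k x) = TensorProduct.map (antipode k) (antipode k)
      (TensorProduct.comm k A A (comul x)) := by
  let G : A →ₗ[k] A ⊗[k] A := TensorProduct.map (antipode k) (antipode k) ∘ₗ
    (TensorProduct.comm k A A).toLinearMap ∘ₗ comul
  have h1 : WithConv.toConv G * WithConv.toConv (comul : A →ₗ[k] A ⊗[k] A) = 1 := by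
    ext c
    rw [(ℛ k c).convMul_apply, LinearMap.convOne_apply]
    exact comul_mul_comul_antipode_flip c
  have h2 := LinearMap.comul_right_inv (R := k) (C := A)
  have h3 := left_inv_eq_right_inv h1 h2
  have h4 := congrArg (fun g => g.ofConv x) h3
  exact h4.symm

end Sweedler

section RMatrix

variable {k : Type u} {A : Type v} {M : Type*} [Field k] [Ring A] [HopfAlgebra k A]
  [AddCommMonoid M] [Module k M]

/-- The element `∑ aᵢ ⊗ bᵢ` given by finite families `a`, `b` is a triangular structure. -/
structure TriData (k : Type u) (A : Type v) [Field k] [Ring A] [HopfAlgebra k A]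
    (ι : Type*) (s : Finset ι) (a b : ι → A) : Prop where
  tri : IsTriangular k (∑ i ∈ s, a i ⊗ₜ[k] b i)

variable {ι : Type*} {s : Finset ι} {a b : ι → A}

namespace TriData

lemma sum_comul_left (h : TriData k A ι s a b) {f : A → A → A → M} (hf : IsTrilin k f) :
    ∑ i ∈ s, ∑ p ∈ (ℛ k (a i)).index, f ((ℛ k (a i)).left p) ((ℛ k (a i)).right p) (b i) =
      ∑ i ∈ s, ∑ j ∈ s, f (a i) (a j) (b i * b j) := by
  have := congrArg hf.lin h.tri.comul_left
  simp only [map_sum, Algebra.TensorProduct.map_tmul, leg13, leg23, Finset.sum_mul_sum,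
    Algebra.TensorProduct.includeRight_apply, AlgHom.id_apply,
    Algebra.TensorProduct.tmul_mul_tmul, mul_one, one_mul, IsTrilin.lin_tmul] at this
  rw [← this]
  refine Finset.sum_congr rfl fun i _ => ?_
  rw [Bialgebra.comulAlgHom_apply, ← (ℛ k (a i)).eq, sum_tmul]
  simp [map_sum]

lemma sum_comul_right (h : TriData k A ι s a b) {f : A → A → A → M} (hf : IsTrilin k f) :
    ∑ i ∈ s, ∑ p ∈ (ℛ k (b i)).index, f (a i) ((ℛ k (b i)).left p) ((ℛ k (b i)).right p) =
      ∑ i ∈ s, ∑ j ∈ s, f (a i * a j) (b j) (b i) := by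
  have := congrArg hf.lin h.tri.comul_right
  simp only [map_sum, Algebra.TensorProduct.map_tmul, leg13, leg12, Finset.sum_mul_sum,
    Algebra.TensorProduct.includeRight_apply, Algebra.TensorProduct.includeLeft_apply,
    AlgHom.id_apply,
    Algebra.TensorProduct.tmul_mul_tmul, mul_one, one_mul, IsTrilin.lin_tmul] at this
  rw [← this]
  refine Finset.sum_congr rfl fun i _ => ?_
  rw [Bialgebra.comulAlgHom_apply, ← (ℛ k (b i)).eq, tmul_sum]
  simp [map_sum]

lemma comul_op (h : TriData k A ι s a b) (x : A) :
    TensorProduct.comm k A A (comul x) * ∑ i ∈ s, a i ⊗ₜ[k] b i =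
      (∑ i ∈ s, a i ⊗ₜ[k] b i) * comul x :=
  h.tri.comul_op x

lemma flip_eq : flip k A (∑ i ∈ s, a i ⊗ₜ[k] b i) = ∑ i ∈ s, b i ⊗ₜ[k] a i := by
  simp [flip, map_sum]

lemma mul_flip (h : TriData k A ι s a b) :
    (∑ i ∈ s, a i ⊗ₜ[k] b i) * ∑ i ∈ s, b i ⊗ₜ[k] a i = 1 := by
  rw [← flip_eq (k := k) (a := a) (b := b)]; exact h.tri.mul_flip

lemma flip_mul (h : TriData k A ι s a b) :
    (∑ i ∈ s, b i ⊗ₜ[k] a i) * ∑ i ∈ s, a i ⊗ₜ[k] b i = 1 := by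
  rw [← flip_eq (k := k) (a := a) (b := b)]; exact h.tri.flip_mul

lemma sum_mul_flip (h : TriData k A ι s a b) {f : A → A → M} (hf : IsBilin k f) :
    ∑ i ∈ s, ∑ j ∈ s, f (a i * b j) (b i * a j) = f 1 1 := by
  have := congrArg hf.lin h.mul_flip
  simpa [Finset.sum_mul_sum, Algebra.TensorProduct.one_def] using this

lemma sum_counit_smul (h : TriData k A ι s a b) :
    ∑ i ∈ s, counit (R := k) (a i) • b i = 1 := by
  have hf : IsTrilin k (fun x y z : A => counit (R := k) x • (y ⊗ₜ[k] z)) := by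
    constructor <;> intros <;> simp [add_smul, tmul_add, add_tmul, ← smul_tmul', smul_smul, mul_comm]
  have h1 := h.sum_comul_left hf
  have h2 : ∀ i, ∑ p ∈ (ℛ k (a i)).index, counit (R := k) ((ℛ k (a i)).left p) •
      ((ℛ k (a i)).right p ⊗ₜ[k] b i) = a i ⊗ₜ b i := fun i =>
    sum_counit_left ((TensorProduct.mk k A A).flip (b i)) (a i)
  simp only [h2] at h1
  set c := ∑ i ∈ s, counit (R := k) (a i) • b i with hc
  have h3 : ∑ i ∈ s, ∑ j ∈ s, counit (R := k) (a i) • (a j ⊗ₜ[k] (b i * b j)) =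
      (1 ⊗ₜ c) * ∑ j ∈ s, a j ⊗ₜ[k] b j := by
    rw [hc, tmul_sum, Finset.sum_mul_sum]
    simp
  rw [h3] at h1
  have h4 : (1 : A ⊗[k] A) = 1 ⊗ₜ c := by
    have := congrArg (· * ∑ i ∈ s, b i ⊗ₜ[k] a i) h1
    simpa only [mul_assoc, h.mul_flip, mul_one] using this
  have h5 := congrArg (TensorProduct.lift ((LinearMap.lsmul k A) ∘ₗ counit)) h4
  simpa [Algebra.TensorProduct.one_def] using h5.symm

lemma antipode_left (h : TriData k A ι s a b) :
    ∑ i ∈ s, antipode k (a i) ⊗ₜ[k] b i = ∑ i ∈ s, b i ⊗ₜ[k] a i := by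
  have hf : IsTrilin k (fun x y z : A => (antipode k x * y) ⊗ₜ[k] z) := by
    constructor <;> intros <;> simp [add_mul, mul_add, tmul_add, add_tmul, ← smul_tmul']
  have h1 := h.sum_comul_left hf
  have h2 : ∀ i, ∑ p ∈ (ℛ k (a i)).index, (antipode k ((ℛ k (a i)).left p) *
      (ℛ k (a i)).right p) ⊗ₜ[k] b i = 1 ⊗ₜ (counit (R := k) (a i) • b i) := fun i => by
    rw [← sum_tmul, sum_antipode_mul_eq_smul, smul_tmul]
  simp only [h2] at h1
  rw [← tmul_sum, h.sum_counit_smul] at h1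
  have h3 : (∑ i ∈ s, antipode k (a i) ⊗ₜ[k] b i) * ∑ i ∈ s, a i ⊗ₜ[k] b i = 1 := by
    rw [Finset.sum_mul_sum]
    simpa [Algebra.TensorProduct.one_def] using h1.symm
  exact left_inv_eq_right_inv h3 h.mul_flip

lemma sum_antipode_left (h : TriData k A ι s a b) {f : A → A → M} (hf : IsBilin k f) :
    ∑ i ∈ s, f (antipode k (a i)) (b i) = ∑ i ∈ s, f (b i) (a i) := by
  simpa using congrArg hf.lin h.antipode_left

end TriData

end RMatrix

section Drinfeld

variable {k : Type u} {A : Type v} {M : Type*} [Field k] [Ring A] [HopfAlgebra k A]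
  [AddCommMonoid M] [Module k M]
variable {ι : Type*} {s : Finset ι} {a b : ι → A}

lemma drinfeldElement_sum (k : Type u) {A : Type v} [Field k] [Ring A] [HopfAlgebra k A]
    {ι : Type*} (s : Finset ι) (a b : ι → A) :
    drinfeldElement k (∑ i ∈ s, a i ⊗ₜ[k] b i) = ∑ i ∈ s, antipode k (b i) * a i := by
  simp [drinfeldElement, flip, map_sum]

namespace TriData

lemma sum_comul_op (h : TriData k A ι s a b) {f : A → A → M} (hf : IsBilin k f) (x : A) :
    ∑ p ∈ (ℛ k x).index, ∑ i ∈ s, f ((ℛ k x).right p * a i) ((ℛ k x).left p * b i) =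
      ∑ i ∈ s, ∑ p ∈ (ℛ k x).index, f (a i * (ℛ k x).left p) (b i * (ℛ k x).right p) := by
  have := congrArg hf.lin (h.comul_op x)
  rw [← (ℛ k x).eq] at this
  simpa [Finset.sum_mul_sum, map_sum] using this

lemma sum_swap (h : TriData k A ι s a b) {f : A → A → M} (hf : IsBilin k f) :
    ∑ i ∈ s, f (a i) (b i) = ∑ i ∈ s, f (b i) (antipode k (a i)) := by
  have hg : IsBilin k (fun x y => f y x) :=
    ⟨fun x x' y => hf.add_right y x x', fun c x y => hf.smul_right c y x,
      fun x y y' => hf.add_left y y' x, fun c x y => hf.smul_left c y x⟩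
  exact (h.sum_antipode_left hg).symm

lemma sum_antipode_drinfeld_mul (h : TriData k A ι s a b) (y : A) :
    ∑ p ∈ (ℛ k y).index, antipode k ((ℛ k y).right p) * (∑ i ∈ s, antipode k (b i) * a i) *
      (ℛ k y).left p = counit (R := k) y • ∑ i ∈ s, antipode k (b i) * a i := by
  have hf : IsBilin k (fun x y : A => antipode k y * x) := by
    constructor <;> intros <;> simp [mul_add, add_mul]
  have h1 := h.sum_comul_op hf y
  simp only [antipode_mul_antidistrib] at h1
  calc _ = _ := by
          simp only [Finset.mul_sum, Finset.sum_mul]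
          rw [Finset.sum_comm]
          exact Finset.sum_congr rfl fun i _ => Finset.sum_congr rfl fun p _ => by
            simp only [mul_assoc]
    _ = _ := h1.symm
    _ = ∑ i ∈ s, antipode k (b i) * (∑ p ∈ (ℛ k y).index,
          antipode k ((ℛ k y).left p) * (ℛ k y).right p) * a i := by
          simp only [Finset.mul_sum, Finset.sum_mul]
          rw [Finset.sum_comm]
          exact Finset.sum_congr rfl fun i _ => Finset.sum_congr rfl fun p _ => by
            simp only [mul_assoc]
    _ = _ := by simp [sum_antipode_mul_eq_smul, Finset.smul_sum]

/-- The square of the antipode is conjugation by the Drinfeld element. -/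
lemma antipode_antipode_mul (h : TriData k A ι s a b) (x : A) :
    antipode k (antipode k x) * (∑ i ∈ s, antipode k (b i) * a i) =
      (∑ i ∈ s, antipode k (b i) * a i) * x := by
  set d := ∑ i ∈ s, antipode k (b i) * a i with hd
  have hf : IsTrilin k (fun x y z : A => antipode k (antipode k z) * (antipode k y * d * x)) := by
    constructor <;> intros <;> simp [mul_add, add_mul]
  have h1 := sum_comul_comul hf x
  simp only [← Finset.mul_sum] at h1
  simp only [hd, h.sum_antipode_drinfeld_mul] at h1
  simp only [← hd] at h1
  have h2 := sum_counit_left ((LinearMap.mulRight k d) ∘ₗ antipode k ∘ₗ antipode k) x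
  have h3 := sum_counit_right (LinearMap.mulLeft k d) x
  simp only [LinearMap.comp_apply, LinearMap.mulRight_apply, LinearMap.mulLeft_apply] at h2 h3
  rw [← h2, ← h3]
  calc _ = _ := Finset.sum_congr rfl fun p _ => by rw [mul_smul_comm]
    _ = _ := h1
    _ = ∑ p ∈ (ℛ k x).index, antipode k (∑ q ∈ (ℛ k ((ℛ k x).right p)).index,
          (ℛ k ((ℛ k x).right p)).left q * antipode k ((ℛ k ((ℛ k x).right p)).right q)) *
            (d * (ℛ k x).left p) := by
          simp only [map_sum, antipode_mul_antidistrib, Finset.sum_mul, mul_assoc]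
    _ = _ := by simp [sum_mul_antipode_eq_smul]

lemma inv_mul_drinfeld (h : TriData k A ι s a b) :
    (∑ j ∈ s, b j * antipode k (antipode k (a j))) * (∑ i ∈ s, antipode k (b i) * a i) = 1 := by
  have hf : IsBilin k (fun x y : A => antipode k y * x) := by
    constructor <;> intros <;> simp [mul_add, add_mul]
  have hg : IsBilin k (fun x y : A => y * (∑ i ∈ s, antipode k (b i) * a i) * x) := by
    constructor <;> intros <;> simp [mul_add, add_mul]
  have h1 := h.sum_mul_flip hf
  rw [Finset.sum_mul]
  simp only [mul_assoc, h.antipode_antipode_mul]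
  simp only [← mul_assoc]
  rw [h.sum_swap hg]
  simp only [antipode_one, mul_one] at h1
  rw [← h1, Finset.sum_comm]
  refine Finset.sum_congr rfl fun i _ => ?_
  rw [Finset.mul_sum, Finset.sum_mul]
  refine Finset.sum_congr rfl fun j _ => ?_
  simp only [antipode_mul_antidistrib, mul_assoc]

lemma antipode_bijective [FiniteDimensional k A] (h : TriData k A ι s a b) :
    Function.Bijective (antipode k (A := A)) := by
  have hinj : Function.Injective (antipode k (A := A)) := by
    rw [injective_iff_map_eq_zero]
    intro x hx
    have h1 := h.antipode_antipode_mul x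
    rw [hx, map_zero, zero_mul] at h1
    have h2 := congrArg ((∑ j ∈ s, b j * antipode k (antipode k (a j))) * ·) h1
    simpa [← mul_assoc, h.inv_mul_drinfeld] using h2.symm
  exact ⟨hinj, LinearMap.injective_iff_surjective.1 hinj⟩

end TriData

end Drinfeld

section Inverse

variable {k : Type u} {A : Type v} [Field k] [Ring A] [HopfAlgebra k A]
  {T : A →ₗ[k] A}

lemma inverse_antidistrib (h1 : ∀ x, antipode k (T x) = x) (h2 : ∀ x, T (antipode k x) = x)
    (x y : A) : T (x * y) = T y * T x := by
  conv_lhs => rw [← h1 x, ← h1 y, ← antipode_mul_antidistrib, h2]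

lemma sum_inverse_mul (h1 : ∀ x, antipode k (T x) = x) (h2 : ∀ x, T (antipode k x) = x) (x : A) :
    ∑ p ∈ (ℛ k x).index, T ((ℛ k x).right p) * (ℛ k x).left p = counit (R := k) x • 1 := by
  have hT1 : T 1 = 1 := by simpa using h2 1
  have := congrArg T (sum_antipode_mul_eq_smul (R := k) (ℛ k x))
  simpa [inverse_antidistrib h1 h2, h2, hT1] using this

lemma sum_mul_inverse (h1 : ∀ x, antipode k (T x) = x) (h2 : ∀ x, T (antipode k x) = x) (x : A) :
    ∑ p ∈ (ℛ k x).index, (ℛ k x).right p * T ((ℛ k x).left p) = counit (R := k) x • 1 := by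
  have hT1 : T 1 = 1 := by simpa using h2 1
  have := congrArg T (sum_mul_antipode_eq_smul (R := k) (ℛ k x))
  simpa [inverse_antidistrib h1 h2, h2, hT1] using this

end Inverse

section GroupLike

variable {k : Type u} {A : Type v} [Field k] [Ring A] [HopfAlgebra k A]
variable {ι : Type*} {s : Finset ι} {a b : ι → A} {T : A →ₗ[k] A}

namespace TriData

lemma one_tmul_mul (h : TriData k A ι s a b) (h1 : ∀ x, antipode k (T x) = x)
    (h2 : ∀ x, T (antipode k x) = x) (x : A) :
    ∑ p ∈ (ℛ k x).index, (T ((ℛ k x).right p) ⊗ₜ[k] 1) *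
      ((∑ i ∈ s, a i ⊗ₜ[k] b i) * comul ((ℛ k x).left p)) =
      (1 ⊗ₜ x) * ∑ i ∈ s, a i ⊗ₜ[k] b i := by
  set R := ∑ i ∈ s, a i ⊗ₜ[k] b i with hR
  have hf : IsTrilin k (fun x y z : A => ((T z * y) ⊗ₜ[k] x) * R) := by
    constructor <;> intros <;> simp [mul_add, add_mul, tmul_add, add_tmul, ← smul_tmul']
  have hc := sum_comul_comul hf x
  calc _ = _ := Finset.sum_congr rfl fun p _ => by
            rw [← h.comul_op, ← (ℛ k ((ℛ k x).left p)).eq, map_sum, Finset.sum_mul,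
              Finset.mul_sum]
            refine Finset.sum_congr rfl fun q _ => ?_
            rw [comm_tmul, ← mul_assoc, Algebra.TensorProduct.tmul_mul_tmul, one_mul]
    _ = _ := hc
    _ = ∑ p ∈ (ℛ k x).index, counit (R := k) ((ℛ k x).right p) •
          (LinearMap.mulRight k R ∘ₗ TensorProduct.mk k A A 1) ((ℛ k x).left p) :=
        Finset.sum_congr rfl fun p _ => by
          rw [← Finset.sum_mul, ← sum_tmul, sum_inverse_mul h1 h2]
          simp [← smul_tmul']
    _ = _ := by rw [sum_counit_right]; simp

lemma sum_comul_mul_inverse (h1 : ∀ x, antipode k (T x) = x)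
    (h2 : ∀ x, T (antipode k x) = x) (x : A) :
    ∑ p ∈ (ℛ k x).index, comul ((ℛ k x).right p) * (T ((ℛ k x).left p) ⊗ₜ[k] 1) =
      (1 : A) ⊗ₜ[k] x := by
  have hf : IsTrilin k (fun x y z : A => ((y * T x) ⊗ₜ[k] z)) := by
    constructor <;> intros <;> simp [mul_add, add_mul, tmul_add, add_tmul, ← smul_tmul']
  have hc := sum_comul_comul hf x
  calc _ = _ := Finset.sum_congr rfl fun p _ => by
            rw [← (ℛ k ((ℛ k x).right p)).eq, Finset.sum_mul]
            refine Finset.sum_congr rfl fun q _ => ?_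
            rw [Algebra.TensorProduct.tmul_mul_tmul, mul_one]
    _ = _ := hc.symm
    _ = ∑ p ∈ (ℛ k x).index, counit (R := k) ((ℛ k x).left p) •
          (TensorProduct.mk k A A 1) ((ℛ k x).right p) :=
        Finset.sum_congr rfl fun p _ => by
          rw [← sum_tmul, sum_mul_inverse h1 h2]
          simp [← smul_tmul']
    _ = _ := by rw [sum_counit_left]; simp

lemma inverse_comul_exchange (h : TriData k A ι s a b) (h1 : ∀ x, antipode k (T x) = x)
    (h2 : ∀ x, T (antipode k x) = x) (x : A) :
    ∑ p ∈ (ℛ k x).index, ∑ i ∈ s,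
        (T ((ℛ k x).right p) * a i) ⊗ₜ[k] (b i * (ℛ k x).left p) =
      ∑ p ∈ (ℛ k x).index, ∑ i ∈ s,
        (a i * T ((ℛ k x).left p)) ⊗ₜ[k] ((ℛ k x).right p * b i) := by
  set R := ∑ i ∈ s, a i ⊗ₜ[k] b i with hR
  have hf : IsTrilin k (fun x y z : A =>
      (T z ⊗ₜ[k] 1) * (R * comul y) * (T x ⊗ₜ[k] (1 : A))) := by
    constructor <;> intros <;> simp [mul_add, add_mul, add_tmul, ← smul_tmul']
  have hc := sum_comul_comul hf x
  calc _ = ∑ p ∈ (ℛ k x).index, (T ((ℛ k x).right p) ⊗ₜ[k] 1) * R * (1 ⊗ₜ (ℛ k x).left p) := by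
          simp [hR, Finset.mul_sum, Finset.sum_mul]
    _ = _ := Finset.sum_congr rfl fun p _ => by
          rw [← sum_comul_mul_inverse h1 h2 ((ℛ k x).left p), Finset.mul_sum]
    _ = _ := by simpa only [mul_assoc] using hc
    _ = ∑ p ∈ (ℛ k x).index, (1 ⊗ₜ (ℛ k x).right p) * R * (T ((ℛ k x).left p) ⊗ₜ[k] 1) :=
        Finset.sum_congr rfl fun p _ => by
          rw [← h.one_tmul_mul h1 h2, Finset.sum_mul]
          simp only [mul_assoc, ← hR]
    _ = _ := by simp [hR, Finset.mul_sum, Finset.sum_mul]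

lemma inverse_right (h : TriData k A ι s a b) (h2 : ∀ x, T (antipode k x) = x) :
    ∑ i ∈ s, T (b i) ⊗ₜ[k] a i = ∑ i ∈ s, a i ⊗ₜ[k] b i := by
  have hf : IsBilin k (fun x y : A => T y ⊗ₜ[k] x) := by
    constructor <;> intros <;> simp [tmul_add, add_tmul, ← smul_tmul']
  rw [h.sum_swap hf]; simp [h2]

/-- The Drinfeld element of a triangular Hopf algebra is grouplike. -/
lemma comul_drinfeld [FiniteDimensional k A] (h : TriData k A ι s a b) :
    comul (∑ i ∈ s, antipode k (b i) * a i) =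
      (∑ i ∈ s, antipode k (b i) * a i) ⊗ₜ[k] (∑ i ∈ s, antipode k (b i) * a i) := by
  let e := LinearEquiv.ofBijective (antipode k (A := A)) h.antipode_bijective
  obtain ⟨T, h1, h2⟩ : ∃ T : A →ₗ[k] A, (∀ x, antipode k (T x) = x) ∧
      ∀ x, T (antipode k x) = x :=
    ⟨e.symm.toLinearMap, fun x => e.apply_symm_apply x, fun x => e.symm_apply_apply x⟩
  set d := ∑ i ∈ s, antipode k (b i) * a i with hd
  have hSd : ∀ x, antipode k x * d = d * T x := fun x => by
    have := h.antipode_antipode_mul (T x)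
    rwa [h1] at this
  let G : A →ₗ[k] A ⊗[k] A := TensorProduct.map (antipode k) (antipode k) ∘ₗ
    (TensorProduct.comm k A A).toLinearMap ∘ₗ comul
  have hG : ∀ x, G x = ∑ p ∈ (ℛ k x).index,
      antipode k ((ℛ k x).right p) ⊗ₜ[k] antipode k ((ℛ k x).left p) := fun x => by
    simp only [G, LinearMap.comp_apply]
    rw [← (ℛ k x).eq]; simp [map_sum]
  have hGS : ∀ x, comul (antipode k x) = G x := comul_antipode
  have hGmul : ∀ x y, G (x * y) = G y * G x := fun x y => by
    rw [← hGS, antipode_mul_antidistrib, Bialgebra.comul_mul, hGS, hGS]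
  have hf1 : IsTrilin k (fun x y z : A => G z * (x ⊗ₜ[k] y)) := by
    constructor <;> intros <;> simp [mul_add, add_mul, tmul_add, add_tmul, ← smul_tmul']
  have e1 : comul d = ∑ i ∈ s, ∑ j ∈ s, G (b i * b j) * (a i ⊗ₜ[k] a j) := by
    rw [← h.sum_comul_left hf1, hd, map_sum]
    refine Finset.sum_congr rfl fun i _ => ?_
    rw [Bialgebra.comul_mul, hGS, ← Finset.mul_sum, (ℛ k (a i)).eq]
  have e2 : ∀ y, ∑ i ∈ s, G (b i) * (a i ⊗ₜ[k] y) =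
      ∑ j ∈ s, (d * a j) ⊗ₜ[k] (antipode k (b j) * y) := fun y => by
    have hf2 : IsTrilin k (fun x z w : A => (antipode k w * x) ⊗ₜ[k] (antipode k z * y)) := by
      constructor <;> intros <;> simp [mul_add, add_mul, tmul_add, add_tmul, ← smul_tmul']
    have := h.sum_comul_right hf2
    calc _ = _ := Finset.sum_congr rfl fun i _ => by
            rw [hG, Finset.sum_mul]
            simp only [Algebra.TensorProduct.tmul_mul_tmul]
      _ = _ := this
      _ = _ := by
        rw [Finset.sum_comm]
        refine Finset.sum_congr rfl fun j _ => ?_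
        rw [← sum_tmul, hd, Finset.sum_mul]
        simp only [mul_assoc]
  have e3 : ∀ c, ∑ i ∈ s, G c * ((d * a i) ⊗ₜ[k] antipode k (b i)) =
      (d ⊗ₜ 1) * ∑ p ∈ (ℛ k c).index, ∑ i ∈ s, (a i * T ((ℛ k c).left p)) ⊗ₜ[k]
        (antipode k (b i) * antipode k ((ℛ k c).right p)) := fun c => by
    have := congrArg (TensorProduct.map LinearMap.id (antipode k))
      (h.inverse_comul_exchange h1 h2 c)
    simp only [map_sum, _root_.TensorProduct.map_tmul, LinearMap.id_apply,
      antipode_mul_antidistrib] at this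
    rw [← this, hG]
    simp only [Finset.sum_mul, Finset.mul_sum]
    rw [Finset.sum_comm]
    refine Finset.sum_congr rfl fun p _ => Finset.sum_congr rfl fun i _ => ?_
    simp only [Algebra.TensorProduct.tmul_mul_tmul, one_mul]
    rw [← mul_assoc, hSd, mul_assoc]
  have hf4 : IsTrilin k (fun x y z : A => ∑ i ∈ s, (a i * T y) ⊗ₜ[k]
      (antipode k (b i) * antipode k z * x)) := by
    constructor <;> intros <;> simp [mul_add, add_mul, tmul_add, add_tmul, ← smul_tmul',
      Finset.sum_add_distrib, Finset.smul_sum]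
  have e4 := h.sum_comul_right hf4
  calc comul d = ∑ j ∈ s, G (b j) * ∑ i ∈ s, G (b i) * (a i ⊗ₜ[k] a j) := by
        rw [e1, Finset.sum_comm]
        simp only [hGmul, Finset.mul_sum, mul_assoc]
    _ = ∑ j ∈ s, (∑ i ∈ s, G (b j) * ((d * a i) ⊗ₜ[k] antipode k (b i))) * (1 ⊗ₜ a j) := by
        refine Finset.sum_congr rfl fun j _ => ?_
        rw [e2, Finset.mul_sum, Finset.sum_mul]
        simp only [mul_assoc, Algebra.TensorProduct.tmul_mul_tmul, mul_one]
    _ = (d ⊗ₜ 1) * ∑ j ∈ s, ∑ p ∈ (ℛ k (b j)).index, ∑ i ∈ s,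
          (a i * T ((ℛ k (b j)).left p)) ⊗ₜ[k]
            (antipode k (b i) * antipode k ((ℛ k (b j)).right p) * a j) := by
        rw [Finset.mul_sum]
        refine Finset.sum_congr rfl fun j _ => ?_
        rw [e3, mul_assoc, Finset.sum_mul]
        simp only [Finset.sum_mul, Algebra.TensorProduct.tmul_mul_tmul, mul_one]
    _ = (d ⊗ₜ 1) * ∑ j ∈ s, ∑ l ∈ s, ∑ i ∈ s, (a i * T (b l)) ⊗ₜ[k]
            (antipode k (b i) * antipode k (b j) * (a j * a l)) := by rw [e4]
    _ = (d ⊗ₜ 1) * ∑ l ∈ s, ∑ i ∈ s, (a i * T (b l)) ⊗ₜ[k] (d * (T (b i) * a l)) := by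
        congr 1
        rw [Finset.sum_comm]
        refine Finset.sum_congr rfl fun l _ => ?_
        rw [Finset.sum_comm]
        refine Finset.sum_congr rfl fun i _ => ?_
        rw [← tmul_sum, ← mul_assoc d, ← hSd, hd, Finset.mul_sum, Finset.sum_mul]
        simp only [mul_assoc]
    _ = (d ⊗ₜ d) * ((∑ i ∈ s, a i ⊗ₜ[k] T (b i)) * ∑ l ∈ s, T (b l) ⊗ₜ[k] a l) := by
        rw [Finset.sum_mul_sum, Finset.sum_comm, ← mul_one d, ← one_mul d,
          ← Algebra.TensorProduct.tmul_mul_tmul, mul_assoc]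
        simp [Finset.mul_sum]
    _ = d ⊗ₜ d := by
        have h5 : ∑ i ∈ s, a i ⊗ₜ[k] T (b i) = ∑ i ∈ s, b i ⊗ₜ[k] a i := by
          have := congrArg (TensorProduct.comm k A A) (h.inverse_right h2)
          simpa using this
        rw [h5, h.inverse_right h2, h.flip_mul, mul_one]

end TriData

end GroupLike

section Integral

variable {k : Type u} {A : Type v} [Field k] [Ring A] [HopfAlgebra k A]

/-- A two-sided integral of counit one. -/
structure IsNormalizedIntegral (k : Type u) {A : Type v} [Field k] [Ring A] [HopfAlgebra k A]
    (L : A) : Prop where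
  mul_left : ∀ a, a * L = counit (R := k) a • L
  mul_right : ∀ a, L * a = counit (R := k) a • L
  counit_eq : counit (R := k) L = 1

lemma exists_left_integral [IsSemisimpleRing A] :
    ∃ L : A, (∀ a, a * L = counit (R := k) a • L) ∧ counit (R := k) L = 1 := by
  let I : Submodule A A :=
    { carrier := {x | counit (R := k) x = 0}
      add_mem' := fun {x y} hx hy => by
        simp only [Set.mem_ofPred_eq] at *; rw [map_add, hx, hy, add_zero]
      zero_mem' := by simp
      smul_mem' := fun c x hx => by
        simp only [Set.mem_ofPred_eq] at *
        rw [smul_eq_mul, Bialgebra.counit_mul, hx, mul_zero] }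
  have hI : ∀ x, x ∈ I ↔ counit (R := k) x = 0 := fun x => Iff.rfl
  obtain ⟨J, hJ⟩ := exists_isCompl I
  obtain ⟨i, hi, j, hj, hij⟩ : ∃ i ∈ I, ∃ j ∈ J, i + j = 1 := by
    have : (1 : A) ∈ I ⊔ J := by rw [hJ.sup_eq_top]; trivial
    exact Submodule.mem_sup.1 this
  refine ⟨j, fun a => ?_, ?_⟩
  · have h1 : (a - algebraMap k A (counit a)) * j ∈ I ⊓ J := by
      refine ⟨?_, J.smul_mem _ hj⟩
      show _ ∈ I
      rw [hI, Bialgebra.counit_mul, map_sub, Bialgebra.counit_algebraMap, sub_self, zero_mul]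
    rw [hJ.inf_eq_bot, Submodule.mem_bot, sub_mul, sub_eq_zero] at h1
    rw [h1, Algebra.smul_def]
  · have := congrArg (counit (R := k)) hij
    rwa [map_add, (hI i).1 hi, zero_add, Bialgebra.counit_one] at this

lemma exists_integral [IsSemisimpleRing A]
    (hS : Function.Surjective (antipode k (A := A))) : ∃ L : A, IsNormalizedIntegral k L := by
  obtain ⟨L, hL, h1⟩ := exists_left_integral (k := k) (A := A)
  have hr : ∀ a, antipode k L * a = counit (R := k) a • antipode k L := fun a => by
    obtain ⟨b, rfl⟩ := hS a
    rw [← antipode_mul_antidistrib, hL, map_smul, counit_antipode]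
  have hSL : antipode k L = L := by
    have e1 := hL (antipode k L)
    rw [hr, h1, one_smul, counit_antipode, h1, one_smul] at e1
    exact e1
  rw [hSL] at hr
  exact ⟨L, hL, hr, h1⟩

namespace IsNormalizedIntegral

variable {L : A} (hL : IsNormalizedIntegral k L)
include hL

lemma sum_mul_tmul_antipode (a : A) :
    ∑ p ∈ (ℛ k L).index, (a * (ℛ k L).left p) ⊗ₜ[k] antipode k ((ℛ k L).right p) =
      ∑ p ∈ (ℛ k L).index, (ℛ k L).left p ⊗ₜ[k] (antipode k ((ℛ k L).right p) * a) := by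
  set W : A ⊗[k] A →ₗ[k] A ⊗[k] A := TensorProduct.map LinearMap.id (antipode k) with hW
  have hWx : ∀ x y : A, W ((x ⊗ₜ y) * comul L) = ∑ p ∈ (ℛ k L).index,
      (x * (ℛ k L).left p) ⊗ₜ[k] (antipode k ((ℛ k L).right p) * antipode k y) := fun x y => by
    conv_lhs => rw [← (ℛ k L).eq]
    simp [Finset.mul_sum, hW, antipode_mul_antidistrib]
  have hf : IsTrilin k (fun x y z : A => W ((x ⊗ₜ y) * comul L) * (1 ⊗ₜ[k] z)) := by
    constructor <;> intros <;> simp [mul_add, add_mul, tmul_add, add_tmul, ← smul_tmul']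
  have hc := sum_comul_comul hf a
  have hW0 : W (comul L) = ∑ p ∈ (ℛ k L).index,
      (ℛ k L).left p ⊗ₜ[k] antipode k ((ℛ k L).right p) := by
    conv_lhs => rw [← (ℛ k L).eq]
    simp [hW]
  calc _ = ∑ q ∈ (ℛ k a).index, counit (R := k) ((ℛ k a).right q) •
        (W ∘ₗ LinearMap.mulRight k (comul L) ∘ₗ (TensorProduct.mk k A A).flip 1)
          ((ℛ k a).left q) := by
        rw [sum_counit_right]
        simp [hWx]
    _ = _ := by
        refine Finset.sum_congr rfl fun q _ => ?_
        simp only [LinearMap.comp_apply, LinearMap.flip_apply, mk_apply,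
          LinearMap.mulRight_apply, hWx, antipode_one, mul_one, Finset.sum_mul,
          Algebra.TensorProduct.tmul_mul_tmul]
        rw [Finset.sum_comm, Finset.smul_sum]
        refine Finset.sum_congr rfl fun p _ => ?_
        rw [← tmul_sum]
        simp only [mul_assoc]
        rw [← Finset.mul_sum, sum_antipode_mul_eq_smul]
        simp
    _ = _ := hc.symm
    _ = ∑ q ∈ (ℛ k a).index, counit (R := k) ((ℛ k a).left q) •
        (LinearMap.mulLeft k (W (comul L)) ∘ₗ TensorProduct.mk k A A 1)
          ((ℛ k a).right q) := by
        refine Finset.sum_congr rfl fun q _ => ?_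
        rw [← Finset.sum_mul, ← map_sum, ← Finset.sum_mul, (ℛ k ((ℛ k a).left q)).eq,
          ← Bialgebra.comul_mul, hL.mul_left]
        simp
    _ = _ := by
        rw [sum_counit_left]
        simp [hW0, Finset.sum_mul]

lemma sum_mul_tmul (a : A) :
    ∑ p ∈ (ℛ k L).index, ((ℛ k L).left p * a) ⊗ₜ[k] (ℛ k L).right p =
      ∑ p ∈ (ℛ k L).index, (ℛ k L).left p ⊗ₜ[k] ((ℛ k L).right p * antipode k a) := by
  have hf : IsTrilin k (fun x y z : A => comul (R := k) L * (x ⊗ₜ (y * antipode k z))) := by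
    constructor <;> intros <;> simp [mul_add, add_mul, tmul_add, add_tmul, ← smul_tmul']
  have hc := sum_comul_comul hf a
  calc _ = comul L * (a ⊗ₜ 1) := by
        conv_rhs => rw [← (ℛ k L).eq]
        simp [Finset.sum_mul]
    _ = ∑ q ∈ (ℛ k a).index, counit (R := k) ((ℛ k a).right q) •
        (LinearMap.mulLeft k (comul L) ∘ₗ (TensorProduct.mk k A A).flip 1)
          ((ℛ k a).left q) := by
        rw [sum_counit_right]; simp
    _ = _ := by
        refine Finset.sum_congr rfl fun q _ => ?_
        rw [← Finset.mul_sum, ← tmul_sum, sum_mul_antipode_eq_smul]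
        simp
    _ = _ := hc.symm
    _ = ∑ q ∈ (ℛ k a).index, counit (R := k) ((ℛ k a).left q) •
        (LinearMap.mulLeft k (comul L) ∘ₗ TensorProduct.mk k A A 1 ∘ₗ antipode k)
          ((ℛ k a).right q) := by
        refine Finset.sum_congr rfl fun q _ => ?_
        have : ∀ t, (ℛ k ((ℛ k a).left q)).left t ⊗ₜ[k]
            ((ℛ k ((ℛ k a).left q)).right t * antipode k ((ℛ k a).right q)) =
            ((ℛ k ((ℛ k a).left q)).left t ⊗ₜ[k] (ℛ k ((ℛ k a).left q)).right t) *
            (1 ⊗ₜ antipode k ((ℛ k a).right q)) := by simp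
        simp only [this]
        rw [← Finset.mul_sum, ← Finset.sum_mul, (ℛ k ((ℛ k a).left q)).eq, ← mul_assoc,
          ← Bialgebra.comul_mul, hL.mul_right]
        simp
    _ = _ := by
        rw [sum_counit_left]
        conv_lhs => rw [LinearMap.comp_apply, LinearMap.mulLeft_apply, ← (ℛ k L).eq]
        simp [Finset.sum_mul]

lemma exists_dual [FiniteDimensional k A] : ∃ l : A →ₗ[k] k,
    ∑ p ∈ (ℛ k L).index, l (antipode k ((ℛ k L).right p)) • (ℛ k L).left p = 1 := by
  let Ψ : (A →ₗ[k] k) →ₗ[k] A :=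
    ∑ p ∈ (ℛ k L).index,
      (LinearMap.applyₗ (antipode k ((ℛ k L).right p))).smulRight ((ℛ k L).left p)
  have hΨ : ∀ l, Ψ l = ∑ p ∈ (ℛ k L).index,
      l (antipode k ((ℛ k L).right p)) • (ℛ k L).left p := fun l => by
    simp [Ψ, LinearMap.sum_apply]
  have hmul : ∀ l a, Ψ l * a ∈ LinearMap.range Ψ := fun l a => by
    refine ⟨l ∘ₗ LinearMap.mulLeft k (antipode k (antipode k a)), ?_⟩
    have hf : IsBilin k (fun x y : A => l (antipode k y) • x) := by
      constructor <;> intros <;> simp [add_smul, smul_smul, mul_comm]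
    have := congrArg hf.lin (hL.sum_mul_tmul a)
    simp only [map_sum, IsBilin.lin_tmul, antipode_mul_antidistrib] at this
    simp only [hΨ, LinearMap.comp_apply, LinearMap.mulLeft_apply, ← this, Finset.sum_mul,
      smul_mul_assoc]
  have h1 : (1 : A) ∈ LinearMap.range Ψ := by
    let e := Module.finBasis k A
    have h2 : (1 : A) = ∑ i, Ψ (e.coord i) * e i := by
      have h3 : ∀ x y : A, x * y = ∑ i, (e.coord i y • x) * e i := fun x y => by
        conv_lhs => rw [← e.sum_repr y]
        simp only [Finset.mul_sum, mul_smul_comm, smul_mul_assoc, Module.Basis.coord_apply]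
      calc (1 : A) = ∑ p ∈ (ℛ k L).index,
            (ℛ k L).left p * antipode k ((ℛ k L).right p) := by
            rw [sum_mul_antipode_eq_smul, hL.counit_eq, one_smul]
        _ = _ := by
            simp only [hΨ, Finset.sum_mul]
            rw [Finset.sum_comm]
            exact Finset.sum_congr rfl fun p _ => h3 _ _
    rw [h2]
    exact Submodule.sum_mem _ fun i _ => hmul _ _
  obtain ⟨l, hl⟩ := h1
  exact ⟨l, by rw [← hΨ, hl]⟩

variable {l : A →ₗ[k] k}

lemma trace_eq [FiniteDimensional k A]
    (hl : ∑ p ∈ (ℛ k L).index, l (antipode k ((ℛ k L).right p)) • (ℛ k L).left p = 1)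
    (f : A →ₗ[k] A) : LinearMap.trace k A f =
      ∑ p ∈ (ℛ k L).index, l (antipode k ((ℛ k L).right p) * f ((ℛ k L).left p)) := by
  have hrec : ∀ a, ∑ p ∈ (ℛ k L).index,
      l (antipode k ((ℛ k L).right p) * a) • (ℛ k L).left p = a := fun a => by
    have hf : IsBilin k (fun x y : A => l y • x) := by
      constructor <;> intros <;> simp [add_smul, smul_smul, mul_comm]
    have := congrArg hf.lin (hL.sum_mul_tmul_antipode a)
    simp only [map_sum, IsBilin.lin_tmul] at this
    rw [← this]
    simp only [← mul_smul_comm, ← Finset.mul_sum, hl, mul_one]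
  have hdec : f = ∑ p ∈ (ℛ k L).index,
      (l ∘ₗ LinearMap.mulLeft k (antipode k ((ℛ k L).right p))).smulRight
        (f ((ℛ k L).left p)) := by
    ext a
    conv_lhs => rw [← hrec a]
    simp [LinearMap.sum_apply]
  conv_lhs => rw [hdec]
  simp [map_sum]

lemma trace_antipode_sq [FiniteDimensional k A]
    (hl : ∑ p ∈ (ℛ k L).index, l (antipode k ((ℛ k L).right p)) • (ℛ k L).left p = 1) :
    LinearMap.trace k A (antipode k ∘ₗ antipode k) = l 1 := by
  rw [hL.trace_eq hl]
  simp only [LinearMap.comp_apply, ← antipode_mul_antidistrib, ← map_sum]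
  rw [sum_antipode_mul_eq_smul, hL.counit_eq, one_smul, antipode_one]

end IsNormalizedIntegral

end Integral

section RegularCharacter

variable (k : Type u) (A : Type v) [Field k] [Ring A] [HopfAlgebra k A]

/-- The character of the regular representation. -/
noncomputable def regChar : A →ₗ[k] k := LinearMap.trace k A ∘ₗ LinearMap.mul k A

/-- Convolution with the regular character, `a ↦ χ(a₁) a₂`. -/
noncomputable def regConv : A →ₗ[k] A :=
  TensorProduct.lift (LinearMap.lsmul k A ∘ₗ regChar k A) ∘ₗ comul

variable {k A}

lemma regChar_apply (a : A) : regChar k A a = LinearMap.trace k A (LinearMap.mulLeft k a) := rfl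

lemma regConv_apply (a : A) : regConv k A a =
    ∑ p ∈ (ℛ k a).index, regChar k A ((ℛ k a).left p) • (ℛ k a).right p := by
  rw [regConv, LinearMap.comp_apply, ← (ℛ k a).eq]; simp

variable [FiniteDimensional k A]

/-- The square of the regular character is a multiple of itself. -/
lemma sum_regChar_mul_regChar (a : A) :
    ∑ p ∈ (ℛ k a).index, regChar k A ((ℛ k a).left p) * regChar k A ((ℛ k a).right p) =
      (Module.finrank k A : k) * regChar k A a := by
  have hg : IsBilin k (fun b c : A => comul (R := k) b * (1 ⊗ₜ[k] c)) := by
    constructor <;> intros <;> simp [mul_add, add_mul, tmul_add]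
  have hsurj : Function.Surjective hg.lin := by
    intro t
    induction t with
    | zero => exact ⟨0, map_zero _⟩
    | add x y hx hy =>
      obtain ⟨x', rfl⟩ := hx
      obtain ⟨y', rfl⟩ := hy
      exact ⟨x' + y', map_add _ _ _⟩
    | tmul b c =>
      refine ⟨∑ p ∈ (ℛ k b).index,
        (ℛ k b).left p ⊗ₜ[k] (antipode k ((ℛ k b).right p) * c), ?_⟩
      have hf : IsTrilin k (fun x y z : A => x ⊗ₜ[k] (y * (antipode k z * c))) := by
        constructor <;> intros <;> simp [mul_add, add_mul, tmul_add, add_tmul, ← smul_tmul']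
      have hc := sum_comul_comul hf b
      calc _ = _ := by
              rw [map_sum]
              refine Finset.sum_congr rfl fun p _ => ?_
              rw [hg.lin_tmul, ← (ℛ k ((ℛ k b).left p)).eq, Finset.sum_mul]
              simp only [Algebra.TensorProduct.tmul_mul_tmul, mul_one]
        _ = _ := hc
        _ = ∑ p ∈ (ℛ k b).index, counit (R := k) ((ℛ k b).right p) •
              ((TensorProduct.mk k A A).flip c) ((ℛ k b).left p) := by
              refine Finset.sum_congr rfl fun p _ => ?_
              rw [← tmul_sum]
              simp only [← mul_assoc]
              rw [← Finset.sum_mul, sum_mul_antipode_eq_smul]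
              simp
        _ = _ := by rw [sum_counit_right]; simp
  let e := LinearEquiv.ofBijective hg.lin ⟨LinearMap.injective_iff_surjective.2 hsurj, hsurj⟩
  have hconj : e.conj (TensorProduct.map (LinearMap.mulLeft k a) LinearMap.id) =
      ∑ p ∈ (ℛ k a).index, TensorProduct.map (LinearMap.mulLeft k ((ℛ k a).left p))
        (LinearMap.mulLeft k ((ℛ k a).right p)) := by
    have h1 : ∑ p ∈ (ℛ k a).index, TensorProduct.map (LinearMap.mulLeft k ((ℛ k a).left p))
        (LinearMap.mulLeft k ((ℛ k a).right p)) = LinearMap.mulLeft k (comul a) := by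
      ext x y
      rw [← (ℛ k a).eq]
      simp [LinearMap.sum_apply, Finset.sum_mul]
    rw [h1]
    apply LinearMap.ext
    intro t
    obtain ⟨s, rfl⟩ := e.surjective t
    rw [LinearEquiv.conj_apply_apply, LinearEquiv.symm_apply_apply]
    have h2 : ∀ s, e s = hg.lin s := fun _ => rfl
    rw [h2, h2]
    induction s with
    | zero => simp
    | add x y hx hy => simp only [map_add, hx, hy]
    | tmul b c => simp [mul_assoc]
  have htr := LinearMap.trace_conj' (TensorProduct.map (LinearMap.mulLeft k a) LinearMap.id) e
  rw [hconj, map_sum] at htr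
  simp only [LinearMap.trace_tensorProduct', LinearMap.trace_id] at htr
  simp only [regChar_apply, htr, mul_comm]

lemma regConv_regConv (a : A) :
    regConv k A (regConv k A a) = (Module.finrank k A : k) • regConv k A a := by
  have hf : IsTrilin k (fun x y z : A => (regChar k A x * regChar k A y) • z) := by
    constructor <;> intros <;> simp [add_mul, mul_add, add_smul, smul_smul] <;> ring_nf
  have hc := sum_comul_comul hf a
  calc _ = _ := by
        conv_lhs => rw [regConv_apply a, map_sum]
        refine Finset.sum_congr rfl fun p _ => ?_
        rw [map_smul, regConv_apply, Finset.smul_sum]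
        simp only [smul_smul]
    _ = _ := hc.symm
    _ = _ := by
        rw [regConv_apply, Finset.smul_sum]
        refine Finset.sum_congr rfl fun p _ => ?_
        rw [← Finset.sum_smul, sum_regChar_mul_regChar, smul_smul]

lemma trace_antipode_sq_comp_regConv {L : A} (hL : IsNormalizedIntegral k L) :
    LinearMap.trace k A ((antipode k ∘ₗ antipode k) ∘ₗ regConv k A) =
      LinearMap.trace k A (antipode k ∘ₗ antipode k) := by
  obtain ⟨l, hl⟩ := hL.exists_dual
  rw [hL.trace_antipode_sq hl, hL.trace_eq hl]
  have hf : IsTrilin k (fun x y z : A => regChar k A x • l (antipode k (antipode k y * z))) := by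
    constructor <;> intros <;> simp [add_mul, mul_add] <;> ring_nf
  have hc := sum_comul_comul hf L
  have hχ : regChar k A L = 1 := by
    have : LinearMap.mulLeft k L = (counit : A →ₗ[k] k).smulRight L := by
      ext a; simp [hL.mul_right]
    rw [regChar_apply, this, LinearMap.trace_smulRight, hL.counit_eq]
  calc _ = _ := by
        refine Finset.sum_congr rfl fun p _ => ?_
        rw [LinearMap.comp_apply, regConv_apply, map_sum, Finset.mul_sum, map_sum]
        refine Finset.sum_congr rfl fun q _ => ?_
        rw [map_smul, mul_smul_comm, map_smul, LinearMap.comp_apply, ← antipode_mul_antidistrib]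
    _ = _ := hc
    _ = ∑ p ∈ (ℛ k L).index, counit (R := k) ((ℛ k L).right p) •
          ((regChar k A).smulRight (l 1)) ((ℛ k L).left p) := by
        refine Finset.sum_congr rfl fun p _ => ?_
        rw [← Finset.smul_sum, ← map_sum, ← map_sum, sum_antipode_mul_eq_smul]
        simp; ring
    _ = l 1 := by rw [sum_counit_right]; simp [hχ]

lemma regConv_antipode_sq {d e : A} (hd : ∀ x, antipode k (antipode k x) * d = d * x)
    (hde : d * e = 1) (x : A) :
    regConv k A (antipode k (antipode k x)) = antipode k (antipode k (regConv k A x)) := by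
  have hσ : ∀ y, regChar k A (antipode k (antipode k y)) = regChar k A y := fun y => by
    have h1 : antipode k (antipode k y) = d * y * e := by
      rw [← hd, mul_assoc, hde, mul_one]
    have h2 : e * d = 1 := by
      have : IsNoetherianRing A := IsNoetherianRing.of_finite k A
      exact mul_eq_one_comm.1 hde
    rw [regChar_apply, regChar_apply, h1, LinearMap.mulLeft_mul, LinearMap.trace_comp_comm',
      ← LinearMap.mulLeft_mul, ← mul_assoc, h2, one_mul]
  have hcom : comul (antipode k (antipode k x)) =
      TensorProduct.map (antipode k ∘ₗ antipode k) (antipode k ∘ₗ antipode k) (comul x) := by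
    rw [comul_antipode, comul_antipode, ← (ℛ k x).eq]
    simp [map_sum]
  rw [regConv, LinearMap.comp_apply, hcom, LinearMap.comp_apply, ← (ℛ k x).eq]
  simp [map_sum, hσ]

end RegularCharacter

section Spectral

variable {k V : Type*} [Field k] [AddCommGroup V] [Module k V] {M : ℕ} {ζ : k}

/-- The projection onto the `ζ ^ a`-eigenspace of an operator of order dividing `M`. -/
noncomputable def eigenProj (M : ℕ) (ζ : k) (g : Module.End k V) (a : ℕ) : Module.End k V :=
  (M : k)⁻¹ • ∑ j ∈ Finset.range M, (ζ⁻¹) ^ (a * j) • g ^ j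

lemma mul_eigenProj (hM : 0 < M) (hζ : IsPrimitiveRoot ζ M) {g : Module.End k V}
    (hg : g ^ M = 1) (a : ℕ) : g * eigenProj M ζ g a = ζ ^ a • eigenProj M ζ g a := by
  have h0 : ζ ≠ 0 := hζ.ne_zero hM.ne'
  have h1 : ∑ j ∈ Finset.range M, (ζ⁻¹) ^ (a * (j + 1)) • g ^ (j + 1) =
      ∑ j ∈ Finset.range M, (ζ⁻¹) ^ (a * j) • g ^ j := by
    have e1 := Finset.sum_range_succ (fun j => ((ζ⁻¹) ^ (a * j) • g ^ j : Module.End k V)) M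
    have e2 := Finset.sum_range_succ' (fun j => ((ζ⁻¹) ^ (a * j) • g ^ j : Module.End k V)) M
    have e3 : (ζ⁻¹) ^ (a * M) = 1 := by
      rw [mul_comm, pow_mul, inv_pow, hζ.pow_eq_one, inv_one, one_pow]
    rw [e1] at e2
    simp only [hg, e3, mul_zero, pow_zero, one_smul] at e2
    exact (add_right_cancel e2).symm
  rw [eigenProj, mul_smul_comm, smul_comm (ζ ^ a)]
  congr 1
  conv_rhs => rw [← h1]
  rw [Finset.mul_sum, Finset.smul_sum]
  refine Finset.sum_congr rfl fun j _ => ?_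
  rw [mul_smul_comm, smul_smul, ← pow_succ', mul_add, mul_one, pow_add ζ⁻¹, mul_left_comm,
    ← mul_pow, mul_inv_cancel₀ h0, one_pow, mul_one]

lemma pow_mul_eigenProj (hM : 0 < M) (hζ : IsPrimitiveRoot ζ M) {g : Module.End k V}
    (hg : g ^ M = 1) (a t : ℕ) :
    g ^ t * eigenProj M ζ g a = ζ ^ (a * t) • eigenProj M ζ g a := by
  induction t with
  | zero => simp
  | succ t ih =>
    rw [pow_succ', mul_assoc, ih, mul_smul_comm, mul_eigenProj hM hζ hg, smul_smul, mul_add,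
      mul_one, pow_add]

lemma eigenProj_mul_self [CharZero k] (hM : 0 < M) (hζ : IsPrimitiveRoot ζ M) {g : Module.End k V}
    (hg : g ^ M = 1) (a : ℕ) :
    eigenProj M ζ g a * eigenProj M ζ g a = eigenProj M ζ g a := by
  have h0 : ζ ≠ 0 := hζ.ne_zero hM.ne'
  conv_lhs => enter [1]; rw [eigenProj]
  rw [smul_mul_assoc, Finset.sum_mul]
  simp only [smul_mul_assoc, pow_mul_eigenProj hM hζ hg, smul_smul, ← mul_pow,
    inv_mul_cancel₀ h0, one_pow, one_smul]
  rw [Finset.sum_const, Finset.card_range, ← Nat.cast_smul_eq_nsmul k, smul_smul,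
    inv_mul_cancel₀ (by exact_mod_cast hM.ne'), one_smul]

lemma sum_eigenProj [CharZero k] (hM : 0 < M) (hζ : IsPrimitiveRoot ζ M) (g : Module.End k V) :
    ∑ a ∈ Finset.range M, eigenProj M ζ g a = 1 := by
  have hc : ∀ j ∈ Finset.range M, ∑ a ∈ Finset.range M, (ζ⁻¹) ^ (a * j) =
      if j = 0 then (M : k) else 0 := by
    intro j hj
    split_ifs with h
    · simp [h]
    · have h1 : (ζ⁻¹) ^ j ≠ 1 :=
        hζ.inv.pow_ne_one_of_pos_of_lt h (Finset.mem_range.1 hj)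
      have h2 := geom_sum_mul ((ζ⁻¹) ^ j) M
      rw [← pow_mul, mul_comm j M, pow_mul, inv_pow ζ M, hζ.pow_eq_one, inv_one, one_pow,
        sub_self] at h2
      rcases mul_eq_zero.1 h2 with h3 | h3
      · rw [← h3]
        exact Finset.sum_congr rfl fun a _ => by rw [mul_comm, pow_mul]
      · exact absurd (sub_eq_zero.1 h3) h1
  simp only [eigenProj]
  rw [← Finset.smul_sum, Finset.sum_comm]
  simp only [← Finset.sum_smul]
  rw [Finset.sum_congr rfl fun j hj => by rw [hc j hj]]
  simp only [ite_smul, zero_smul, Finset.sum_ite_eq', Finset.mem_range, hM, if_true, pow_zero]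
  rw [smul_smul, inv_mul_cancel₀ (by exact_mod_cast hM.ne'), one_smul]

/-- Traces of powers of an operator of finite order, on the image of an idempotent commuting with
it, are power sums of roots of unity with multiplicities in `ℕ`. -/
lemma exists_multiplicities [CharZero k] [FiniteDimensional k V] (hM : 0 < M) (hζ : IsPrimitiveRoot ζ M) {g P : Module.End k V}
    (hg : g ^ M = 1) (hP : P * P = P) (hgP : Commute g P) :
    ∃ r : ℕ → ℕ, (∀ t, LinearMap.trace k V (g ^ t * P) =
        ∑ a ∈ Finset.range M, (r a : k) * ζ ^ (a * t)) ∧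
      ∀ a₀ ∈ Finset.range M, (∀ a ∈ Finset.range M, a ≠ a₀ → r a = 0) →
        g * P = ζ ^ a₀ • P := by
  set p := eigenProj M ζ g with hp
  have hpP : ∀ a, Commute (p a) P := fun a => by
    rw [hp, eigenProj]
    exact (Commute.sum_left _ _ _ fun j _ => (hgP.pow_left j).smul_left _).smul_left _
  have hid : ∀ a, IsIdempotentElem (p a * P) := fun a => by
    rw [IsIdempotentElem, mul_assoc, ← mul_assoc P, ← (hpP a).eq, mul_assoc (p a) P P, hP,
      ← mul_assoc, eigenProj_mul_self hM hζ hg]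
  have hsum : ∀ t, g ^ t * P = ∑ a ∈ Finset.range M, ζ ^ (a * t) • (p a * P) := fun t => by
    conv_lhs => rw [← mul_one (g ^ t), ← sum_eigenProj hM hζ g, Finset.mul_sum, Finset.sum_mul]
    exact Finset.sum_congr rfl fun a _ => by rw [pow_mul_eigenProj hM hζ hg, smul_mul_assoc]
  have htr : ∀ a, LinearMap.trace k V (p a * P) =
      (Module.finrank k (LinearMap.range (p a * P)) : k) := fun a =>
    (LinearMap.IsIdempotentElem.isProj_range _ (hid a)).trace
  refine ⟨fun a => Module.finrank k (LinearMap.range (p a * P)), fun t => ?_, ?_⟩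
  · rw [hsum, map_sum]
    exact Finset.sum_congr rfl fun a _ => by rw [map_smul, htr, smul_eq_mul, mul_comm]
  · intro a₀ ha₀ h
    have hz : ∀ a ∈ Finset.range M, a ≠ a₀ → p a * P = 0 := fun a ha hne => by
      have := h a ha hne
      rwa [Submodule.finrank_eq_zero, LinearMap.range_eq_bot] at this
    have h1 : ∀ t, g ^ t * P = ζ ^ (a₀ * t) • (p a₀ * P) := fun t => by
      rw [hsum]
      refine Finset.sum_eq_single a₀ (fun a ha hne => ?_) (fun hn => absurd ha₀ hn)
      rw [hz a ha hne, smul_zero]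
    have h2 := h1 0
    have h3 := h1 1
    simp only [pow_zero, mul_zero, one_mul, one_smul, pow_one, mul_one] at h2 h3
    rw [h3, ← h2]

end Spectral

section Cyclotomic

variable {K : Type*} [Field K] {M : ℕ} {η : K}

lemma norm_embedding_pow (hM : 0 < M) (hη : IsPrimitiveRoot η M) (φ : K →+* ℂ) (a : ℕ) :
    ‖φ (η ^ a)‖ = 1 := by
  rw [map_pow, norm_pow, Complex.norm_eq_one_of_pow_eq_one (n := M) _ hM.ne', one_pow]
  rw [← map_pow, hη.pow_eq_one, map_one]

/-- If an average of `n` roots of unity is a nonzero algebraic integer, then they are all equal. -/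
lemma exists_unique_weight [NumberField K] (hM : 0 < M) (hη : IsPrimitiveRoot η M) {n : ℕ} (hn : 0 < n)
    (r s : ℕ → ℕ) (hr : ∑ a ∈ Finset.range M, r a = n)
    (h : ∑ a ∈ Finset.range M, (r a : K) * η ^ a =
      n * ∑ a ∈ Finset.range M, (s a : K) * η ^ a)
    (h0 : ∑ a ∈ Finset.range M, (r a : K) * η ^ a ≠ 0) :
    ∃ a₀ ∈ Finset.range M, ∀ a ∈ Finset.range M, a ≠ a₀ → r a = 0 := by
  set y := ∑ a ∈ Finset.range M, (s a : K) * η ^ a with hy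
  have hy0 : y ≠ 0 := fun h1 => h0 (by rw [h, h1, mul_zero])
  have hn' : (0 : ℝ) < n := by exact_mod_cast hn
  have hint : IsIntegral ℤ y := by
    refine IsIntegral.sum _ fun a _ => IsIntegral.mul ?_ ((hη.isIntegral hM).pow a)
    exact_mod_cast isIntegral_algebraMap (R := ℤ) (A := K) (x := (s a : ℤ))
  have hφ : ∀ φ : K →+* ℂ, (n : ℂ) * φ y = ∑ a ∈ Finset.range M, (r a : ℂ) * φ (η ^ a) :=
    fun φ => by
      have := congrArg φ h
      rw [map_mul, map_natCast, map_sum] at this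
      rw [← this]
      exact Finset.sum_congr rfl fun a _ => by rw [map_mul, map_natCast]
  have hle : ∀ φ : K →+* ℂ, ‖φ y‖ ≤ 1 := fun φ => by
    have h1 : (n : ℝ) * ‖φ y‖ ≤ n := by
      calc (n : ℝ) * ‖φ y‖ = ‖(n : ℂ) * φ y‖ := by rw [norm_mul, Complex.norm_natCast]
        _ ≤ ∑ a ∈ Finset.range M, ‖(r a : ℂ) * φ (η ^ a)‖ := by rw [hφ]; exact norm_sum_le _ _
        _ = ∑ a ∈ Finset.range M, (r a : ℝ) := Finset.sum_congr rfl fun a _ => by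
            rw [norm_mul, norm_embedding_pow hM hη, Complex.norm_natCast, mul_one]
        _ = n := by rw [← hr]; push_cast; rfl
    exact le_of_mul_le_mul_left (by rwa [mul_one]) hn'
  obtain ⟨m, hm, hym⟩ := NumberField.Embeddings.pow_eq_one_of_norm_le_one K ℂ hy0 hint hle
  obtain ⟨φ⟩ : Nonempty (K →+* ℂ) := inferInstance
  have hy1 : ‖φ y‖ = 1 :=
    Complex.norm_eq_one_of_pow_eq_one (n := m) (by rw [← map_pow, hym, map_one]) hm.ne'
  set w := φ y with hw
  have hw0 : w ≠ 0 := by rw [← norm_ne_zero_iff, hy1]; exact one_ne_zero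
  have hz1 : ∀ a, ‖φ (η ^ a) / w‖ = 1 := fun a => by
    rw [norm_div, norm_embedding_pow hM hη, hy1, div_one]
  have hre : ∑ a ∈ Finset.range M, (r a : ℝ) * (1 - (φ (η ^ a) / w).re) = 0 := by
    have h1 : ∑ a ∈ Finset.range M, (r a : ℂ) * (φ (η ^ a) / w) = n := by
      have := hφ φ
      rw [← hw, ← eq_div_iff hw0] at this
      rw [this, Finset.sum_div]
      exact Finset.sum_congr rfl fun a _ => by rw [mul_div_assoc]
    have h2 := congrArg Complex.re h1
    rw [Complex.re_sum, Complex.natCast_re] at h2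
    simp only [mul_sub, mul_one, Finset.sum_sub_distrib]
    rw [sub_eq_zero, ← Nat.cast_sum, hr, ← h2]
    exact Finset.sum_congr rfl fun a _ => by simp
  have hterm : ∀ a ∈ Finset.range M, (r a : ℝ) * (1 - (φ (η ^ a) / w).re) = 0 := by
    refine (Finset.sum_eq_zero_iff_of_nonneg fun a _ => ?_).1 hre
    refine mul_nonneg (Nat.cast_nonneg _) (sub_nonneg.2 ?_)
    exact (Complex.re_le_norm _).trans (hz1 a).le
  have hw' : ∀ a ∈ Finset.range M, r a ≠ 0 → φ (η ^ a) = w := fun a ha hra => by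
    have h1 : (φ (η ^ a) / w).re = 1 := by
      rcases mul_eq_zero.1 (hterm a ha) with h2 | h2
      · exact absurd (by exact_mod_cast h2) hra
      · linarith
    have h2 : φ (η ^ a) / w = 1 := by
      have h3 := hz1 a
      have h4 : ‖φ (η ^ a) / w‖ ^ 2 = 1 := by rw [h3, one_pow]
      rw [← Complex.normSq_eq_norm_sq, Complex.normSq_apply, h1] at h4
      have h5 : (φ (η ^ a) / w).im = 0 := by nlinarith
      exact Complex.ext (by simpa using h1) (by simpa using h5)
    rwa [div_eq_one_iff_eq hw0] at h2
  obtain ⟨a₀, ha₀, hra₀⟩ : ∃ a₀ ∈ Finset.range M, r a₀ ≠ 0 := by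
    by_contra hcon
    push Not at hcon
    rw [Finset.sum_eq_zero hcon] at hr
    omega
  refine ⟨a₀, ha₀, fun a ha hne => ?_⟩
  by_contra hra
  have h1 : η ^ a = η ^ a₀ := φ.injective (by rw [hw' a ha hra, hw' a₀ ha₀ hra₀])
  exact hne (hη.pow_inj (Finset.mem_range.1 ha) (Finset.mem_range.1 ha₀) h1)

lemma eq_zero_of_sum_mul_conj [NumberField K] (hM : 0 < M) (hη : IsPrimitiveRoot η M) {ι : Type*} [Fintype ι]
    (r : ι → ℕ → ℕ)
    (h : ∑ i, (∑ a ∈ Finset.range M, (r i a : K) * η ^ a) *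
      (∑ a ∈ Finset.range M, (r i a : K) * η ^ (a * (M - 1))) = 0) (i : ι) :
    ∑ a ∈ Finset.range M, (r i a : K) * η ^ a = 0 := by
  obtain ⟨φ⟩ : Nonempty (K →+* ℂ) := inferInstance
  have hconj : ∀ a, φ (η ^ (a * (M - 1))) = (starRingEnd ℂ) (φ (η ^ a)) := fun a => by
    rw [← Complex.inv_eq_conj (norm_embedding_pow hM hη φ a)]
    refine eq_inv_of_mul_eq_one_left ?_
    rw [← map_mul, ← pow_add, ← Nat.mul_succ, Nat.succ_eq_add_one, Nat.sub_add_cancel hM,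
      mul_comm, pow_mul, hη.pow_eq_one, one_pow, map_one]
  have h1 := congrArg φ h
  rw [map_sum, map_zero] at h1
  have h2 : ∀ i, φ ((∑ a ∈ Finset.range M, (r i a : K) * η ^ a) *
      (∑ a ∈ Finset.range M, (r i a : K) * η ^ (a * (M - 1)))) =
      ((Complex.normSq (φ (∑ a ∈ Finset.range M, (r i a : K) * η ^ a)) : ℝ) : ℂ) := fun i => by
    rw [Complex.normSq_eq_conj_mul_self, mul_comm, map_mul]
    congr 1
    simp only [map_sum, map_mul, map_natCast, hconj]
  simp only [h2] at h1
  rw [← Complex.ofReal_sum, Complex.ofReal_eq_zero,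
    Finset.sum_eq_zero_iff_of_nonneg fun i _ => Complex.normSq_nonneg _] at h1
  have h3 := h1 i (Finset.mem_univ i)
  rw [Complex.normSq_eq_zero] at h3
  exact φ.injective (by rw [h3, map_zero])

end Cyclotomic

section PiMatrix

variable {k : Type*} [Field k] {ι : Type*} [Fintype ι] [DecidableEq ι] {d : ι → ℕ}

lemma pi_matrix_eq_sum (x : Π i, Matrix (Fin (d i)) (Fin (d i)) k) :
    x = ∑ i, ∑ r, ∑ s, x i r s • Pi.single i (Matrix.single r s (1 : k)) := by
  conv_lhs => rw [← Finset.univ_sum_single x]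
  refine Finset.sum_congr rfl fun i _ => ?_
  conv_lhs => rw [Matrix.matrix_eq_sum_single (x i)]
  have hs : ∀ m : Matrix (Fin (d i)) (Fin (d i)) k,
      (Pi.single i m : Π i, Matrix (Fin (d i)) (Fin (d i)) k) =
        LinearMap.single k (fun i => Matrix (Fin (d i)) (Fin (d i)) k) i m := fun _ => rfl
  simp only [hs, map_sum, ← map_smul, Matrix.smul_single, smul_eq_mul, mul_one]

lemma trace_mulLeft_mulRight (u w : Π i, Matrix (Fin (d i)) (Fin (d i)) k) :
    LinearMap.trace k _ (LinearMap.mulLeft k u ∘ₗ LinearMap.mulRight k w) =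
      ∑ i, (u i).trace * (w i).trace := by
  set F := LinearMap.mulLeft k u ∘ₗ LinearMap.mulRight k w with hF
  have hdec : F = ∑ i, ∑ r, ∑ s,
      (Matrix.entryLinearMap k k r s ∘ₗ LinearMap.proj (R := k)
        (φ := fun i => Matrix (Fin (d i)) (Fin (d i)) k) i).smulRight
        (F (Pi.single i (Matrix.single r s (1 : k)))) := by
    apply LinearMap.ext
    intro x
    conv_lhs => rw [pi_matrix_eq_sum x]
    simp only [map_sum, map_smul, LinearMap.sum_apply, LinearMap.smulRight_apply,
      LinearMap.comp_apply, LinearMap.proj_apply, Matrix.entryLinearMap_apply]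
  conv_lhs => rw [hdec]
  simp only [map_sum, LinearMap.trace_smulRight, LinearMap.comp_apply, LinearMap.proj_apply,
    Matrix.entryLinearMap_apply]
  refine Finset.sum_congr rfl fun i _ => ?_
  rw [Matrix.trace, Matrix.trace, Finset.sum_mul_sum]
  refine Finset.sum_congr rfl fun r _ => Finset.sum_congr rfl fun s _ => ?_
  simp [hF, Matrix.mul_apply, Matrix.single_apply, ite_and]

/-- A character of a product of matrix algebras vanishes on elements with vanishing traces. -/
lemma algHom_eq_zero_of_trace_eq_zero [∀ i, NeZero (d i)]
    (t : (Π i, Matrix (Fin (d i)) (Fin (d i)) k) →ₐ[k] k)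
    (u : Π i, Matrix (Fin (d i)) (Fin (d i)) k) (hu : ∀ i, (u i).trace = 0) : t u = 0 := by
  have hmul : ∀ i (r s p q : Fin (d i)),
      (Pi.single i (Matrix.single r s (1 : k)) * Pi.single i (Matrix.single p q (1 : k)) :
        Π i, Matrix (Fin (d i)) (Fin (d i)) k) =
      if s = p then Pi.single i (Matrix.single r q (1 : k)) else 0 := fun i r s p q => by
    rw [← Pi.single_mul]
    split_ifs with h
    · subst h; simp
    · simp [Matrix.single_mul_single_of_ne _ _ _ _ h]
  have hoff : ∀ i (r s : Fin (d i)), t (Pi.single i (Matrix.single r s (1 : k))) =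
      if r = s then t (Pi.single i (Matrix.single 0 0 (1 : k))) else 0 := fun i r s => by
    have h1 := congrArg t (hmul i r 0 0 s)
    have h2 := congrArg t (hmul i 0 s r 0)
    rw [map_mul, if_pos rfl] at h1
    rw [map_mul, mul_comm, h1] at h2
    rw [h2]
    by_cases h : r = s
    · simp [h]
    · simp [h, Ne.symm h]
  rw [pi_matrix_eq_sum u]
  simp only [map_sum, map_smul, smul_eq_mul]
  refine Finset.sum_eq_zero fun i _ => ?_
  obtain ⟨c, hc⟩ : ∃ c, ∀ r s, t (Pi.single i (Matrix.single r s (1 : k))) =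
      if r = s then c else 0 := ⟨_, hoff i⟩
  simp only [hc, mul_ite, mul_zero, Finset.sum_ite_eq, Finset.mem_univ, if_true]
  rw [← Finset.sum_mul]
  have := hu i
  rw [Matrix.trace] at this
  simp only [Matrix.diag_apply] at this
  rw [this, zero_mul]

end PiMatrix

section Order

variable {k : Type u} {A : Type v} [Field k] [Ring A] [HopfAlgebra k A] [FiniteDimensional k A]

lemma exists_pow_eq_one_of_isGroupLikeElem {g : A} (hg : IsGroupLikeElem k g) :
    ∃ M, 0 < M ∧ g ^ M = 1 := by
  have : Finite (GroupLike k A) := (linearIndep_groupLikeVal (R := k) (A := A)).finite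
  obtain ⟨M, hM, h⟩ := (isOfFinOrder_of_finite (⟨g, hg⟩ : GroupLike k A)).exists_pow_eq_one
  exact ⟨M, hM, by simpa using congrArg GroupLike.val h⟩

end Order

section Involutive

variable {k : Type u} {A : Type v} [Field k] [IsAlgClosed k] [CharZero k] [Ring A]
  [HopfAlgebra k A] [FiniteDimensional k A]

lemma trace_conj_ne_zero [IsSemisimpleRing A] {M : ℕ} (hM : 0 < M) {K : Type*} [Field K]
    [NumberField K] {η : K} (hη : IsPrimitiveRoot η M) (ψ : K →+* k) {d : A} (hd : d ^ M = 1)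
    (hε : counit (R := k) d ≠ 0) :
    LinearMap.trace k A (LinearMap.mulLeft k d ∘ₗ LinearMap.mulRight k (d ^ (M - 1))) ≠ 0 := by
  obtain ⟨n, m, hm, ⟨e⟩⟩ := IsSemisimpleRing.exists_algEquiv_pi_matrix_of_isAlgClosed k A
  have hζ : IsPrimitiveRoot (ψ η) M := hη.map_of_injective ψ.injective
  have hpow : ∀ i, Matrix.toLin' (e d i) ^ M = 1 := fun i => by
    rw [← Matrix.toLin'_pow, ← Pi.pow_apply, ← map_pow, hd, map_one]
    exact Matrix.toLin'_one
  have hr : ∀ i, ∃ r : ℕ → ℕ, ∀ t, (e d i ^ t).trace =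
      ∑ a ∈ Finset.range M, (r a : k) * (ψ η) ^ (a * t) := fun i => by
    obtain ⟨r, hr, -⟩ := exists_multiplicities hM hζ (hpow i) (one_mul 1) (Commute.one_right _)
    refine ⟨r, fun t => ?_⟩
    rw [← hr t, mul_one, ← Matrix.toLin'_pow, Matrix.trace_toLin'_eq]
  choose r hr using hr
  have hψ : ∀ i t, (e d i ^ t).trace =
      ψ (∑ a ∈ Finset.range M, (r i a : K) * η ^ (a * t)) := fun i t => by
    rw [hr]; simp
  have htr : LinearMap.trace k A
      (LinearMap.mulLeft k d ∘ₗ LinearMap.mulRight k (d ^ (M - 1))) =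
      ψ (∑ i, (∑ a ∈ Finset.range M, (r i a : K) * η ^ a) *
        (∑ a ∈ Finset.range M, (r i a : K) * η ^ (a * (M - 1)))) := by
    rw [← LinearMap.trace_conj' _ e.toLinearEquiv]
    have : e.toLinearEquiv.conj
        (LinearMap.mulLeft k d ∘ₗ LinearMap.mulRight k (d ^ (M - 1))) =
        LinearMap.mulLeft k (e d) ∘ₗ LinearMap.mulRight k (e d ^ (M - 1)) := by
      apply LinearMap.ext
      intro x
      simp [LinearEquiv.conj_apply_apply]
    rw [this, trace_mulLeft_mulRight, map_sum]
    refine Finset.sum_congr rfl fun i _ => ?_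
    have h1 := hψ i 1
    have h2 := hψ i (M - 1)
    simp only [pow_one, mul_one] at h1
    rw [map_mul, ← h1, ← h2, Pi.pow_apply]
  rw [htr]
  intro h0
  have h1 := eq_zero_of_sum_mul_conj hM hη r (ψ.injective (by rw [h0, map_zero]))
  refine hε ?_
  have h2 := algHom_eq_zero_of_trace_eq_zero ((Bialgebra.counitAlgHom k A).comp e.symm.toAlgHom)
    (e d) fun i => by
      have h3 := hψ i 1
      simp only [pow_one, mul_one, h1, map_zero] at h3
      exact h3
  simpa using h2

/-- If the square of the antipode of a semisimple Hopf algebra over an algebraically closed field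
of characteristic zero is conjugation by a grouplike element, then the antipode is an
involution. -/
theorem antipode_antipode_eq_self [IsSemisimpleRing A]
    (hS : Function.Surjective (antipode k (A := A))) {d : A} (hg : IsGroupLikeElem k d)
    (hd : ∀ x, antipode k (antipode k x) * d = d * x) (x : A) :
    antipode k (antipode k x) = x := by
  obtain ⟨M, hM, hdM⟩ := exists_pow_eq_one_of_isGroupLikeElem hg
  have : NeZero M := ⟨hM.ne'⟩
  have hd1 : d * d ^ (M - 1) = 1 := by
    rw [← pow_succ', Nat.sub_add_cancel hM, hdM]
  have : IsCyclotomicExtension {M} ℚ (CyclotomicField M ℚ) :=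
    CyclotomicField.isCyclotomicExtension M ℚ
  have hη : IsPrimitiveRoot (IsCyclotomicExtension.zeta M ℚ (CyclotomicField M ℚ)) M :=
    IsCyclotomicExtension.zeta_spec M ℚ _
  set η := IsCyclotomicExtension.zeta M ℚ (CyclotomicField M ℚ)
  obtain ⟨ψ⟩ : Nonempty (CyclotomicField M ℚ →+* k) :=
    ⟨(IsAlgClosed.lift (R := ℚ) (S := CyclotomicField M ℚ) (M := k)).toRingHom⟩
  have hζ : IsPrimitiveRoot (ψ η) M := hη.map_of_injective ψ.injective
  have hA : Nontrivial A := ⟨⟨0, 1, fun h => by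
      have := congrArg (counit (R := k)) h
      rw [map_zero, Bialgebra.counit_one] at this
      exact zero_ne_one this⟩⟩
  set n := Module.finrank k A with hn
  have hn0 : 0 < n := Module.finrank_pos
  have hnk : (n : k) ≠ 0 := by exact_mod_cast hn0.ne'
  set σ : Module.End k A := antipode k ∘ₗ antipode k with hσ
  have hσx : ∀ x, σ x = d * x * d ^ (M - 1) := fun x => by
    rw [← hd, mul_assoc, hd1, mul_one]; rfl
  have hσM : σ ^ M = 1 := by
    have h1 : ∀ t x, (σ ^ t) x * d ^ t = d ^ t * x := fun t => by
      induction t with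
      | zero => simp
      | succ t ih =>
        intro x
        rw [pow_succ', Module.End.mul_apply, pow_succ', ← mul_assoc]
        rw [show σ ((σ ^ t) x) * d = d * (σ ^ t) x from hd _, mul_assoc, ih, mul_assoc]
    ext x
    have h2 := h1 M x
    rwa [hdM, mul_one, one_mul] at h2
  obtain ⟨L, hL⟩ := exists_integral hS
  set P : Module.End k A := (n : k)⁻¹ • regConv k A with hP
  have hPP : P * P = P := by
    ext x
    simp only [hP, Module.End.mul_apply, LinearMap.smul_apply, map_smul, regConv_regConv]
    rw [smul_smul (n : k)⁻¹ (n : k), inv_mul_cancel₀ hnk, one_smul]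
  have hσP : Commute σ P := by
    ext x
    simp only [hP, Module.End.mul_apply, LinearMap.smul_apply, map_smul, hσ,
      LinearMap.comp_apply, regConv_antipode_sq hd hd1]
  have htr : LinearMap.trace k A σ = n * LinearMap.trace k A (σ * P) := by
    rw [hP, mul_smul_comm, map_smul, smul_eq_mul, mul_inv_cancel_left₀ hnk]
    exact (trace_antipode_sq_comp_regConv hL).symm
  have htr0 : LinearMap.trace k A σ ≠ 0 := by
    have : σ = LinearMap.mulLeft k d ∘ₗ LinearMap.mulRight k (d ^ (M - 1)) := by
      ext x; simp [hσx, mul_assoc]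
    rw [this]
    exact trace_conj_ne_zero hM hη ψ hdM (by rw [hg.counit_eq_one]; exact one_ne_zero)
  obtain ⟨r, hr, hr1⟩ := exists_multiplicities hM hζ hσM (one_mul 1) (Commute.one_right σ)
  obtain ⟨s, hs, -⟩ := exists_multiplicities hM hζ hσM hPP hσP
  have hrn : ∑ a ∈ Finset.range M, r a = n := by
    have h1 := hr 0
    simp only [pow_zero, mul_one, mul_zero, LinearMap.trace_one] at h1
    exact_mod_cast h1.symm
  have hr' := hr 1
  have hs' := hs 1
  simp only [pow_one, mul_one] at hr' hs'
  have hψr : ∀ r : ℕ → ℕ, ψ (∑ a ∈ Finset.range M, (r a : CyclotomicField M ℚ) * η ^ a) =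
      ∑ a ∈ Finset.range M, (r a : k) * (ψ η) ^ a := fun r => by simp
  obtain ⟨a₀, ha₀, h0⟩ := exists_unique_weight hM hη hn0 r s hrn
    (ψ.injective (by rw [map_mul, map_natCast, hψr, hψr, ← hr', ← hs', htr]))
    (fun h => htr0 (by rw [hr', ← hψr, h, map_zero]))
  have hfin := hr1 a₀ ha₀ h0
  rw [mul_one] at hfin
  have h1 : (ψ η) ^ a₀ = 1 := by
    have h2 := LinearMap.congr_fun hfin 1
    simp only [hσ, LinearMap.comp_apply, antipode_one, LinearMap.smul_apply,
      Module.End.one_apply] at h2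
    have h3 := congrArg (counit (R := k)) h2
    rw [map_smul, Bialgebra.counit_one, smul_eq_mul, mul_one] at h3
    exact h3.symm
  rw [h1, one_smul] at hfin
  exact LinearMap.congr_fun hfin x

end Involutive

section Square

variable {k : Type u} {A : Type v} [Field k] [IsAlgClosed k] [CharZero k] [Ring A]

/-- In a semisimple algebra in characteristic zero, a central sum of commutators is zero. -/
lemma eq_zero_of_central_of_eq_sum_commutators [Algebra k A] [FiniteDimensional k A]
    [IsSemisimpleRing A] {z : A} (hz : ∀ x, x * z = z * x) {ι : Type*} {s : Finset ι}
    {a b : ι → A} (h : z = ∑ i ∈ s, (a i * b i - b i * a i)) : z = 0 := by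
  obtain ⟨n, m, hm, ⟨e⟩⟩ := IsSemisimpleRing.exists_algEquiv_pi_matrix_of_isAlgClosed k A
  refine e.injective ?_
  rw [map_zero]
  funext i
  have htr : (e z i).trace = 0 := by
    rw [h, map_sum, Finset.sum_apply, Matrix.trace_sum]
    refine Finset.sum_eq_zero fun j _ => ?_
    rw [map_sub, map_mul, map_mul, Pi.sub_apply, Matrix.trace_sub, Pi.mul_apply, Pi.mul_apply,
      Matrix.trace_mul_comm, sub_self]
  have hcomm : ∀ X : Matrix (Fin (m i)) (Fin (m i)) k, Commute X (e z i) := fun X => by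
    obtain ⟨x, hx⟩ := e.surjective (Pi.single i X)
    have h1 := congrArg (fun y => e y i) (hz x)
    rw [Commute, SemiconjBy]
    simpa [hx] using h1
  obtain ⟨c, hc⟩ := Matrix.mem_range_scalar_iff_commute_single'.2 fun r t => hcomm _
  rw [← hc] at htr ⊢
  rw [Matrix.scalar_apply, Matrix.trace_diagonal, Finset.sum_const, Finset.card_univ,
    Fintype.card_fin, nsmul_eq_mul] at htr
  rcases mul_eq_zero.1 htr with h0 | h0
  · exact absurd (by exact_mod_cast h0) (hm i).out
  · rw [h0, map_zero]; rfl

variable [HopfAlgebra k A] [FiniteDimensional k A] {R : A ⊗[k] A}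

/-- The Drinfeld element of a semisimple triangular Hopf algebra is a central grouplike element of
square one. -/
theorem drinfeldElement_properties (hR : IsSemisimpleTriangular k R) :
    (∀ x, x * drinfeldElement k R = drinfeldElement k R * x) ∧
      drinfeldElement k R * drinfeldElement k R = 1 ∧
      IsGroupLikeElem k (drinfeldElement k R) := by
  have := hR.semisimple
  obtain ⟨s, hs⟩ := TensorProduct.exists_finset R
  have h : TriData k A (A × A) s Prod.fst Prod.snd := ⟨by rw [← hs]; exact hR.toIsTriangular⟩
  have hdd : drinfeldElement k R = ∑ i ∈ s, antipode k i.2 * i.1 := by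
    rw [hs, drinfeldElement_sum]
  set d := drinfeldElement k R with hd
  have hconj := h.antipode_antipode_mul
  have hinv := h.inv_mul_drinfeld
  have hcom := h.comul_drinfeld
  rw [← hdd] at hinv hcom
  simp only [← hdd] at hconj
  have hg : IsGroupLikeElem k d := by
    refine ⟨?_, hcom⟩
    have h1 := congrArg (counit (R := k)) hinv
    rw [Bialgebra.counit_mul, Bialgebra.counit_one] at h1
    have h2 := rTensor_counit_comul (R := k) d
    rw [hcom] at h2
    have h3 := congrArg (TensorProduct.lid k A) h2
    simp only [LinearMap.rTensor_tmul, _root_.TensorProduct.lid_tmul, one_smul] at h3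
    have h4 := congrArg (counit (R := k)) h3
    rw [map_smul, smul_eq_mul] at h4
    exact mul_right_cancel₀ (right_ne_zero_of_mul_eq_one h1) (by rw [h4, one_mul])
  have hsq := antipode_antipode_eq_self h.antipode_bijective.2 hg hconj
  have hcentral : ∀ x, x * d = d * x := fun x => by rw [← hconj x, hsq]
  refine ⟨hcentral, ?_, hg⟩
  simp only [hsq] at hinv
  set w := ∑ j ∈ s, j.2 * j.1 with hw
  have hd2 : d = ∑ i ∈ s, i.1 * i.2 := by
    have hf : IsBilin k (fun x y : A => antipode k y * x) := by
      constructor <;> intros <;> simp [mul_add, add_mul]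
    rw [hdd, h.sum_swap hf]
    simp only [hsq]
  have hdw : d * w = 1 := by rw [← hcentral, hinv]
  have hwc : ∀ x, x * w = w * x := fun x => by
    calc x * w = w * d * x * w := by rw [hinv, one_mul]
      _ = w * x := by rw [mul_assoc w, ← hcentral, mul_assoc, mul_assoc x, hdw, mul_one]
  have hz : d - w = 0 :=
    eq_zero_of_central_of_eq_sum_commutators (k := k) (s := s) (a := Prod.fst) (b := Prod.snd)
      (fun x => by rw [mul_sub, sub_mul, hcentral, hwc])
      (by rw [hd2, hw, Finset.sum_sub_distrib])
  rw [sub_eq_zero] at hz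
  conv_lhs => rw [hz]
  rwa [← hz, hz] at hdw ⊢

end Square

section Parity

variable {k : Type u} {A : Type v} [Field k] [Ring A] [Algebra k A]

lemma zmod_two_cases (p : ZMod 2) : p = 0 ∨ p = 1 := by
  fin_cases p
  · exact Or.inl rfl
  · exact Or.inr rfl

lemma existsUnique_hasParity [CharZero k] {d : A} (hc : ∀ x, x * d = d * x) (hd : d * d = 1)
    (V : Type v) [AddCommGroup V] [Module k V] [Module A V] [IsScalarTower k A V]
    [IsSimpleModule A V] : ∃! p : ZMod 2, HasParity k d V p := by
  have h0 : HasParity k d V 0 ↔ ∀ w : V, d • w = w := by simp [HasParity]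
  have h1 : HasParity k d V 1 ↔ ∀ w : V, d • w = -w := by
    simp [HasParity, show (1 : ZMod 2).val = 1 from rfl]
  have hex : HasParity k d V 0 ∨ HasParity k d V 1 := by
    rw [h0, h1]
    let W : Submodule A V :=
      { carrier := {w | d • w = w}
        add_mem' := fun {x y} hx hy => by
          rw [Set.mem_ofPred_eq] at *; rw [smul_add, hx, hy]
        zero_mem' := smul_zero d
        smul_mem' := fun c x hx => by
          rw [Set.mem_ofPred_eq] at *; rw [← mul_smul, ← hc, mul_smul, hx] }
    have hW : ∀ w, w ∈ W ↔ d • w = w := fun w => Iff.rfl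
    rcases eq_bot_or_eq_top W with h | h
    · refine Or.inr fun w => ?_
      have h2 : d • w + w ∈ W := by rw [hW, smul_add, ← mul_smul, hd, one_smul, add_comm]
      rw [h, Submodule.mem_bot] at h2
      exact eq_neg_of_add_eq_zero_left h2
    · exact Or.inl fun w => (hW w).1 (by rw [h]; trivial)
  have hnot : ¬ (HasParity k d V 0 ∧ HasParity k d V 1) := by
    rw [h0, h1]
    rintro ⟨e0, e1⟩
    have := IsSimpleModule.nontrivial A V
    obtain ⟨w, hw⟩ := exists_ne (0 : V)
    have h2 : (2 : k) • w = 0 := by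
      rw [two_smul]; nth_rewrite 1 [← e0 w]; rw [e1, neg_add_cancel]
    exact hw ((smul_eq_zero.1 h2).resolve_left two_ne_zero)
  rcases hex with h | h
  · refine ⟨0, h, fun q hq => ?_⟩
    rcases zmod_two_cases q with rfl | rfl
    · rfl
    · exact absurd ⟨h, hq⟩ hnot
  · refine ⟨1, h, fun q hq => ?_⟩
    rcases zmod_two_cases q with rfl | rfl
    · exact absurd ⟨hq, h⟩ hnot
    · rfl

lemma tensorAction_tmul (V W : Type v) [AddCommGroup V] [Module k V] [Module A V]
    [IsScalarTower k A V] [AddCommGroup W] [Module k W] [Module A W] [IsScalarTower k A W]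
    (a b : A) (v : V) (w : W) :
    tensorAction k V W (a ⊗ₜ b) (v ⊗ₜ w) = (a • v) ⊗ₜ (b • w) := by
  simp [tensorAction, Module.endTensorEndAlgHom_apply]

lemma tensorAction_parityMatrix [CharZero k] {d : A} (V W : Type v) [AddCommGroup V] [Module k V] [Module A V]
    [IsScalarTower k A V] [AddCommGroup W] [Module k W] [Module A W] [IsScalarTower k A W]
    {p q : ZMod 2} (hp : HasParity k d V p) (hq : HasParity k d W q) :
    tensorAction k V W (parityMatrix k d) = ((-1 : k) ^ (p * q).val) • 1 := by
  apply TensorProduct.ext'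
  intro v w
  have h1 : (1 : ZMod 2).val = 1 := rfl
  simp only [parityMatrix, map_smul, map_sub, map_add, LinearMap.smul_apply, LinearMap.sub_apply,
    LinearMap.add_apply, tensorAction_tmul, one_smul, hp v, hq w, Module.End.one_apply,
    tmul_smul, ← smul_tmul', smul_smul]
  rw [← one_smul k (v ⊗ₜ[k] w)]
  simp only [smul_smul, ← add_smul, ← sub_smul]
  congr 1
  rcases zmod_two_cases p with rfl | rfl <;> rcases zmod_two_cases q with rfl | rfl <;>
    simp [h1] <;> norm_num

/-- An element of `A ⊗ A` acting by zero on all tensor products of irreducible representations is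
zero. -/
lemma eq_zero_of_tensorAction_eq_zero [IsSemisimpleRing A] {X : A ⊗[k] A}
    (h : ∀ V W : Submodule A A, IsSimpleModule A V → IsSimpleModule A W →
      tensorAction k V W X = 0) : X = 0 := by
  have h1 : ∀ V W : Submodule A A, IsSimpleModule A V → IsSimpleModule A W →
      ∀ v ∈ V, ∀ w ∈ W, X * (v ⊗ₜ w) = 0 := by
    intro V W hV hW v hv w hw
    have h2 : ∀ Y : A ⊗[k] A, TensorProduct.map (V.subtype.restrictScalars k)
        (W.subtype.restrictScalars k) (tensorAction k V W Y (⟨v, hv⟩ ⊗ₜ ⟨w, hw⟩)) =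
        Y * (v ⊗ₜ w) := fun Y => by
      induction Y with
      | zero => simp
      | add x y hx hy => simp only [map_add, LinearMap.add_apply, hx, hy, add_mul]
      | tmul a b => rw [tensorAction_tmul]; simp
    rw [← h2, h V W hV hW, LinearMap.zero_apply, map_zero]
  have htop : ∀ x : A, x ∈ ⨆ m : {m : Submodule A A | IsSimpleModule A m}, (m : Submodule A A) :=
    fun x => by
      rw [← sSup_eq_iSup', IsSemisimpleModule.sSup_simples_eq_top]; trivial
  have h3 : ∀ W : Submodule A A, IsSimpleModule A W → ∀ w ∈ W, ∀ x : A, X * (x ⊗ₜ w) = 0 :=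
    fun W hW w hw x =>
      Submodule.iSup_induction _ (motive := fun x => X * (x ⊗ₜ w) = 0) (htop x)
        (fun V v hv => h1 V W V.2 hW v hv w hw) (by simp)
        (fun y z hy hz => by rw [add_tmul, mul_add, hy, hz, add_zero])
  have h4 : ∀ x y : A, X * (x ⊗ₜ y) = 0 := fun x y =>
      Submodule.iSup_induction _ (motive := fun y => X * (x ⊗ₜ y) = 0) (htop y)
        (fun W w hw => h3 W W.2 w hw x) (by simp)
        (fun y z hy hz => by rw [tmul_add, mul_add, hy, hz, add_zero])
  have := h4 1 1
  rwa [← Algebra.TensorProduct.one_def, mul_one] at this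

lemma isParityModification_iff [CharZero k] [IsSemisimpleRing A] {d : A} (hc : ∀ x, x * d = d * x)
    (hd : d * d = 1) (R R' : A ⊗[k] A) :
    IsParityModification k d R R' ↔ R' = R * parityMatrix k d := by
  constructor
  · intro h
    rw [← sub_eq_zero]
    refine eq_zero_of_tensorAction_eq_zero fun V W hV hW => ?_
    obtain ⟨p, hp, -⟩ := existsUnique_hasParity (k := k) hc hd V
    obtain ⟨q, hq, -⟩ := existsUnique_hasParity (k := k) hc hd W
    rw [map_sub, map_mul, tensorAction_parityMatrix V W hp hq, mul_smul_comm, mul_one,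
      h V W p q hp hq, sub_self]
  · rintro rfl V W _ _ _ _ _ _ _ _ _ _ p q hp hq
    rw [map_mul, tensorAction_parityMatrix V W hp hq, mul_smul_comm, mul_one]

end Parity

section Modification

variable {k : Type u} {A : Type v} [Field k] [Ring A]

lemma parityMatrix_eq_left [Algebra k A] (d : A) : parityMatrix k d =
    ((2⁻¹ : k) • (1 + d)) ⊗ₜ[k] (1 : A) + ((2⁻¹ : k) • (1 - d)) ⊗ₜ[k] d := by
  simp only [parityMatrix, ← smul_tmul', add_tmul, sub_tmul, smul_add, smul_sub]
  abel

lemma parityMatrix_eq_right [Algebra k A] (d : A) : parityMatrix k d =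
    (1 : A) ⊗ₜ[k] ((2⁻¹ : k) • (1 + d)) + d ⊗ₜ[k] ((2⁻¹ : k) • (1 - d)) := by
  simp only [parityMatrix, tmul_smul, tmul_add, tmul_sub, smul_add, smul_sub]
  abel

/-- The idempotents `(1 ± d) / 2`. -/
lemma half_idempotents [CharZero k] [Algebra k A] {d : A} (hd : d * d = 1) :
    let e := (2⁻¹ : k) • (1 + d)
    let f := (2⁻¹ : k) • (1 - d)
    e * e = e ∧ f * f = f ∧ e * f = 0 ∧ f * e = 0 ∧ e + f = 1 ∧ d * e = e := by
  have h4 : (2⁻¹ : k) * 2⁻¹ * 2 = 2⁻¹ := by norm_num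
  have h2 : (2⁻¹ : k) * 2 = 1 := by norm_num
  refine ⟨?_, ?_, ?_, ?_, ?_, ?_⟩
  · rw [smul_mul_smul_comm, show (1 + d) * (1 + d) = (2 : k) • (1 + d) by
      rw [two_smul]; simp only [mul_add, add_mul, hd, one_mul, mul_one]; abel, smul_smul, h4]
  · rw [smul_mul_smul_comm, show (1 - d) * (1 - d) = (2 : k) • (1 - d) by
      rw [two_smul]; simp only [mul_sub, sub_mul, hd, one_mul, mul_one]; abel, smul_smul, h4]
  · rw [smul_mul_smul_comm, show (1 + d) * (1 - d) = 0 by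
      simp only [mul_sub, add_mul, hd, one_mul, mul_one]; abel, smul_zero]
  · rw [smul_mul_smul_comm, show (1 - d) * (1 + d) = 0 by
      simp only [mul_add, sub_mul, hd, one_mul, mul_one]; abel, smul_zero]
  · rw [← smul_add, show (1 + d) + (1 - d) = (2 : k) • (1 : A) by rw [two_smul]; abel, smul_smul,
      h2, one_smul]
  · rw [mul_smul_comm, mul_add, hd, mul_one, add_comm]

variable [HopfAlgebra k A] {R : A ⊗[k] A} {d : A}

lemma commute_tmul_of_central {B : Type*} [Ring B] [Algebra k B] {x : A} {y : B}
    (hx : ∀ z, Commute x z) (hy : ∀ z, Commute y z) (t : A ⊗[k] B) : Commute (x ⊗ₜ[k] y) t := by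
  induction t with
  | zero => exact Commute.zero_right _
  | add s t hs ht => exact hs.add_right ht
  | tmul a b =>
    rw [Commute, SemiconjBy, Algebra.TensorProduct.tmul_mul_tmul,
      Algebra.TensorProduct.tmul_mul_tmul, (hx a).eq, (hy b).eq]

/-- Multiplying a triangular structure by the parity matrix of a central grouplike involution gives
a triangular structure. -/
lemma isTriangular_mul_parityMatrix [CharZero k] (hR : IsTriangular k R) (hc : ∀ x, x * d = d * x)
    (hd : d * d = 1) (hg : IsGroupLikeElem k d) :
    IsTriangular k (R * parityMatrix k d) := by
  obtain ⟨hee, hff, hef, hfe, hef1, hde⟩ := half_idempotents (k := k) hd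
  have hQl := parityMatrix_eq_left (k := k) d
  have hQr := parityMatrix_eq_right (k := k) d
  have hdc : ∀ x, Commute d x := fun x => (hc x).symm
  have hec : ∀ x, Commute ((2⁻¹ : k) • (1 + d)) x := fun x =>
    ((Commute.one_left x).add_left (hdc x)).smul_left _
  have hfc : ∀ x, Commute ((2⁻¹ : k) • (1 - d)) x := fun x =>
    ((Commute.one_left x).sub_left (hdc x)).smul_left _
  have h1c : ∀ x : A, Commute 1 x := Commute.one_left
  set e := (2⁻¹ : k) • (1 + d) with he
  set f := (2⁻¹ : k) • (1 - d) with hf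
  set Q := parityMatrix k d with hQ
  have hflip : flip k A Q = Q := by
    conv_lhs => rw [hQl]
    rw [hQr]; simp [flip]
  have hQQ : Q * Q = 1 := by
    rw [hQl]
    simp only [mul_add, add_mul, Algebra.TensorProduct.tmul_mul_tmul, hee, hff, hef, hfe, hd,
      zero_tmul, add_zero, zero_add, mul_one]
    rw [← add_tmul, hef1, Algebra.TensorProduct.one_def]
  have hQc : ∀ X, Commute Q X := fun X => by
    rw [hQl]
    exact (commute_tmul_of_central hec h1c X).add_left (commute_tmul_of_central hfc hdc X)
  have hdcom : Bialgebra.comulAlgHom k A d = d ⊗ₜ d := hg.comul_eq_tmul_self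
  have h13 : leg13 k A Q = e ⊗ₜ (1 ⊗ₜ 1) + f ⊗ₜ (1 ⊗ₜ d) := by
    rw [hQl]; simp [leg13]
  have h13' : leg13 k A Q = 1 ⊗ₜ (1 ⊗ₜ e) + d ⊗ₜ (1 ⊗ₜ f) := by
    rw [hQr]; simp [leg13]
  have h12 : leg12 k A Q = e ⊗ₜ (1 ⊗ₜ 1) + f ⊗ₜ (d ⊗ₜ 1) := by
    rw [hQl]; simp [leg12]
  have h23 : leg23 k A Q = 1 ⊗ₜ (1 ⊗ₜ e) + 1 ⊗ₜ (d ⊗ₜ f) := by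
    rw [hQr]; simp [leg23, tmul_add]
  have h13c : ∀ X, Commute (leg13 k A Q) X := fun X => by
    rw [h13]
    exact (commute_tmul_of_central hec (commute_tmul_of_central h1c h1c) X).add_left
      (commute_tmul_of_central hfc (commute_tmul_of_central h1c hdc) X)
  refine ⟨?_, ?_, ?_, ?_, fun a => ?_⟩
  · rw [map_mul, hflip, mul_assoc, ← mul_assoc Q, (hQc _).eq, mul_assoc, hQQ, mul_one, hR.mul_flip]
  · rw [map_mul, hflip, mul_assoc, ← mul_assoc Q, (hQc R).eq, mul_assoc, hQQ, mul_one, hR.flip_mul]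
  · rw [map_mul, map_mul, hR.comul_left, map_mul, map_mul, mul_assoc, mul_assoc,
      ← mul_assoc (leg13 k A Q), (h13c (leg23 k A R)).eq, mul_assoc (leg23 k A R)]
    congr 2
    rw [h13', h23, hQr]
    simp [mul_add, add_mul, hdcom, hee, hff, hef, hfe, Algebra.TensorProduct.one_def]
  · rw [map_mul, hR.comul_right, map_mul, map_mul, mul_assoc, mul_assoc,
      ← mul_assoc (leg13 k A Q), (h13c (leg12 k A R)).eq, mul_assoc (leg12 k A R)]
    congr 2
    rw [h13, h12, hQl]
    simp [mul_add, add_mul, hdcom, hee, hff, hef, hfe, Algebra.TensorProduct.one_def]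
  · rw [← mul_assoc, hR.comul_op, mul_assoc, mul_assoc, (hQc _).eq]

lemma drinfeldElement_mul_parityMatrix [CharZero k] (hdR : d = drinfeldElement k R)
    (hd : d * d = 1) (hg : IsGroupLikeElem k d) :
    drinfeldElement k (R * parityMatrix k d) = 1 := by
  obtain ⟨-, -, -, -, hef1, hde⟩ := half_idempotents (k := k) hd
  have hS : antipode k d * d = 1 := hg.antipode_mul_cancel
  have hlin : ∀ x y : A, drinfeldElement k (R * (x ⊗ₜ[k] y)) =
      antipode k y * drinfeldElement k R * x := fun x y => by
    obtain ⟨s, hs⟩ := TensorProduct.exists_finset R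
    have h1 : R * (x ⊗ₜ[k] y) = ∑ i ∈ s, (i.1 * x) ⊗ₜ[k] (i.2 * y) := by
      rw [hs, Finset.sum_mul]; simp
    rw [h1, hs, drinfeldElement_sum, drinfeldElement_sum, Finset.mul_sum, Finset.sum_mul]
    simp only [antipode_mul_antidistrib, mul_assoc]
  have hadd : ∀ X Y : A ⊗[k] A,
      drinfeldElement k (X + Y) = drinfeldElement k X + drinfeldElement k Y := fun X Y => by
    simp [drinfeldElement]
  rw [parityMatrix_eq_left, mul_add, hadd, hlin, hlin, ← hdR, hS, antipode_one, one_mul, one_mul,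
    hde, hef1]

end Modification

end TriangularHopf

theorem lemma4p6 {k : Type u} {A : Type v} [Field k] [IsAlgClosed k] [CharZero k]
    [Ring A] [HopfAlgebra k A] [FiniteDimensional k A]
    (R : A ⊗[k] A) (hR : TriangularHopf.IsSemisimpleTriangular k R)
    (d : A) (hd : d = TriangularHopf.drinfeldElement k R) :
    -- the Drinfeld element is central of square one
    d ∈ Subalgebra.center k A ∧ d ^ 2 = 1 ∧
    -- so that every irreducible representation has a well-defined parity
    (∀ (V : Type v) [AddCommGroup V] [Module k V] [Module A V] [IsScalarTower k A V]
      [IsSimpleModule A V], ∃! p : ZMod 2, TriangularHopf.HasParity k d V p) ∧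
    -- the parity-modified R-matrix exists, is unique, and equals `R * R_u`
    (∀ R' : A ⊗[k] A, TriangularHopf.IsParityModification k d R R' ↔
      R' = R * TriangularHopf.parityMatrix k d) ∧
    TriangularHopf.IsSemisimpleTriangular k (R * TriangularHopf.parityMatrix k d) ∧
    TriangularHopf.drinfeldElement k (R * TriangularHopf.parityMatrix k d) = 1 := by
  have hss := hR.semisimple
  obtain ⟨hc, hsq, hg⟩ := TriangularHopf.drinfeldElement_properties hR
  rw [← hd] at hc hsq hg
  exact ⟨Subalgebra.mem_center_iff.2 hc, by rw [pow_two, hsq],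
    fun V => TriangularHopf.existsUnique_hasParity hc hsq V,
    TriangularHopf.isParityModification_iff hc hsq R,
    ⟨TriangularHopf.isTriangular_mul_parityMatrix hR.toIsTriangular hc hsq hg, hss⟩,
    TriangularHopf.drinfeldElement_mul_parityMatrix hd hsq hg⟩
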